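/- **Notation.** For a category $\mathcal V$ let $\mathbf M\mathcal V$, $\mathbf S\mathcal V$ and $\mathbf B\mathcal V$ be the categories whose objects are the finite sequences $(X_1,\dots,X_n)$, $n\ge 0$, of objects of $\mathcal V$. There are no morphisms between sequences of different lengths, and a morphism $(X_1,\dots,X_n)\to(Y_1,\dots,Y_n)$ is * in $\mathbf M\mathcal V$: a family of morphisms $f_i:X_i\to Y_i$ of $\mathcal V$; * in $\mathbf S\mathcal V$: a pair $(\rho,(f_i)_i)$ of a permutation $\rho\in\Sigma_n$ and morphisms $f_i:X_i\to Y_{\rho(i)}$; * in $\mathbf B\mathcal V$: a pair $(\beta,(f_i)_i)$ of an element $\beta$ of the $n$-strand braid group and morphisms $f_i:X_i\to Y_{|\beta|(i)}$, where $|\beta|\in\Sigma_n$ is the underlying permutation of $\beta$. These are the values at $\mathcal V$ of the 2-monads $\mathbf M,\mathbf S,\mathbf B$ on $\mathbf{CAT}$ for monoidal, symmetric monoidal and braided monoidal categories. A functor $F:\mathcal V\to\mathcal W$ induces $TF:T\mathcal V\to T\mathcal W$ for $T=\mathbf M,\mathbf S,\mathbf B$, by applying $F$ to all the $X_i$ and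 $f_i$. A monoidal (resp. symmetric monoidal, braided monoidal) category $\mathcal V$ is a pseudo $T$-algebra for $T=\mathbf M$ (resp. $\mathbf S$, $\mathbf B$), with action the functor $\bigotimes:T\mathcal V\to\mathcal V$ given on objects by $(X_1,\dots,X_n)\mapsto X_1\otimes(X_2\otimes(\cdots\otimes(X_n\otimes I)))$. On morphisms it sends $(f_i)_i$ to the tensor product of the $f_i$; it sends $(\rho,(f_i)_i)$ (resp. $(\beta,(f_i)_i)$) to the tensor product $\bigotimes_iX_i\to\bigotimes_iY_{\rho(i)}$ (resp. $\bigotimes_iX_i\to\bigotimes_iY_{|\beta|(i)}$) of the $f_i$ followed by the coherence isomorphism to $\bigotimes_jY_j$ that permutes the factors according to $\rho$ by means of the symmetry (resp. according to $\beta$, the generators of the braid group acting by the braiding of two adjacent factors). A colax monoidal functor $F:\mathcal V\to\mathcal W$ is a functor with a natural family $F(A\otimes B)\to FA\otimes FB$ and a morphism $FI\to I$ satisfying the coassociativity and counit axioms. Between symmetric (resp. braided) monoidal categories it is called symmetric (resp. braided) if the maps $F(A\otimes B)\to FA\otimes FB$ commute with the symmetries (resp. braidings). A colax monoidal (resp.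 symmetric colax monoidal, braided colax monoidal) functor is a colax morphism of pseudo $T$-algebras for $T=\mathbf M$ (resp. $\mathbf S$, $\mathbf B$), with coherence 2-cell $\overline F:F\circ\bigotimes\Rightarrow\bigotimes\circ TF$ whose components $F\bigotimes_iX_i\to\bigotimes_iFX_i$ are the iterated comparison maps. It is called *exact* as a colax morphism of pseudo $T$-algebras if this lax square of functors $$\bigotimes:T\mathcal V\to\mathcal V,\qquad TF:T\mathcal V\to T\mathcal W,\qquad F:\mathcal V\to\mathcal W,\qquad \bigotimes:T\mathcal W\to\mathcal W$$ is exact in the sense of Guitart. That is: for all $X\in\mathcal V$, $Y\in T\mathcal W$ and $\gamma:FX\to\bigotimes Y$, the following category of factorizations of $\gamma$ is connected (in particular non-empty). Its objects are the triples $(g,Z,h)$ with $Z\in T\mathcal V$, $g:X\to\bigotimes Z$ and $h:TF(Z)\to Y$ such that $\bigotimes(h)\circ\overline F_Z\circ Fg=\gamma$. A morphism $(g,Z,h)\to(g',Z',h')$ is a morphism $\delta:Z\to Z'$ of $T\mathcal V$ such that $\bigotimes(\delta)\circ g=g'$ and $h=h'\circ TF(\delta)$. **Proposition.** 1. A symmetric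 colax monoidal functor $F:\mathcal V\to\mathcal W$ between symmetric monoidal categories is exact as a colax morphism of pseudo $\mathbf S$-algebras if and only if it is exact as a colax morphism of pseudo $\mathbf M$-algebras. 2. A braided colax monoidal functor $F:\mathcal V\to\mathcal W$ between braided monoidal categories is exact as a colax morphism of pseudo $\mathbf B$-algebras if and only if it is exact as a colax morphism of pseudo $\mathbf M$-algebras. -/

import Mathlib

open CategoryTheory MonoidalCategory

universe w v u v₁ v₂ u₁ u₂

namespace ExactColax

section TensorList

variable {V : Type u} [Category.{v} V] [MonoidalCategory V] {ι : Type w}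

/-- The iterated tensor product `X a₁ ⊗ (X a₂ ⊗ (⋯ ⊗ (X aₖ ⊗ 𝟙_ V)))` of a family of objects along a
list `[a₁, …, aₖ]` of indices. -/
def tensorList (X : ι → V) : List ι → V
  | [] => 𝟙_ V
  | a :: l => X a ⊗ tensorList X l

/-- Functoriality of `tensorList` in the family: `f a₁ ⊗ (f a₂ ⊗ ⋯)`. -/
def tensorListHom {X Y : ι → V} (f : ∀ i, X i ⟶ Y i) :
    ∀ l : List ι, tensorList X l ⟶ tensorList Y l
  | [] => 𝟙 _
  | a :: l => f a ⊗ₘ tensorListHom f l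

lemma tensorListHom_id (X : ι → V) (l : List ι) :
    tensorListHom (fun i => 𝟙 (X i)) l = 𝟙 _ := by
  induction l with
  | nil => rfl
  | cons a l ih => simp [tensorListHom, ih, tensorList]

lemma tensorListHom_comp {X Y Z : ι → V} (f : ∀ i, X i ⟶ Y i) (g : ∀ i, Y i ⟶ Z i)
    (l : List ι) :
    tensorListHom (fun i => f i ≫ g i) l = tensorListHom f l ≫ tensorListHom g l := by
  induction l with
  | nil => exact (Category.comp_id _).symm
  | cons a l ih =>
    change _ ⊗ₘ tensorListHom _ l = (_ ⊗ₘ _) ≫ (_ ⊗ₘ _)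
    rw [ih, tensorHom_comp_tensorHom]

/-- A family of morphisms `X i ⟶ Y (π i)` lying over the permutation `π`. (It is indexed by pairs
`i, j` with `π i = j` only to avoid transporting along equalities of indices.) -/
abbrev FamilyOver (π : Equiv.Perm ι) (X Y : ι → V) := ∀ i j, π i = j → (X i ⟶ Y j)

/-- The morphism `f a₁ ⊗ (f a₂ ⊗ ⋯)` from the tensor product of `X a₁, X a₂, …` to the tensor product
of `Y (π a₁), Y (π a₂), …`; no symmetry is used here. -/
def tensorListPush {π : Equiv.Perm ι} {X Y : ι → V} (f : FamilyOver π X Y) :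
    ∀ l : List ι, tensorList X l ⟶ tensorList Y (l.map π)
  | [] => 𝟙 _
  | a :: l => f a (π a) rfl ⊗ₘ tensorListPush f l

end TensorList

section Wreath

variable {n : ℕ} {G : Type} [Group G]

/-- The wreath product category of `V` with a group `G` acting on `n` letters through `ρ`: its objects
are the sequences of `n` objects of `V`, and a morphism `(X i) ⟶ (Y i)` consists of `g : G` together
with morphisms `X i ⟶ Y (ρ g i)`. -/
structure Wreath (ρ : G →* Equiv.Perm (Fin n)) (V : Type u) where
  obj : Fin n → V

namespace Wreath

variable {ρ : G →* Equiv.Perm (Fin n)} {V : Type u} [Category.{v} V]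

/-- Morphisms of `Wreath ρ V`: an element `g : G` and morphisms `X i ⟶ Y (ρ g i)`. -/
structure Hom (X Y : Wreath ρ V) where
  elt : G
  map : FamilyOver (ρ elt) X.obj Y.obj

lemma Hom.ext' {X Y : Wreath ρ V} {a b : Hom X Y} (h : a.elt = b.elt)
    (hm : ∀ i j hi hj, a.map i j hi = b.map i j hj) : a = b := by
  obtain ⟨a, f⟩ := a
  obtain ⟨b, g⟩ := b
  obtain rfl : a = b := h
  congr 1
  funext i j hi
  exact hm i j hi hi

instance : Category (Wreath ρ V) where
  Hom X Y := Hom X Y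
  id X := ⟨1, fun i _ h => eqToHom (by rw [← h, map_one]; rfl)⟩
  comp {X Y Z} a b := ⟨b.elt * a.elt, fun i j h =>
    a.map i (ρ a.elt i) rfl ≫ b.map (ρ a.elt i) j (by rw [← h, map_mul]; rfl)⟩
  id_comp {X Y} a := by
    apply Hom.ext' (mul_one _)
    intro i j hi hj
    have key : ∀ k (hk : i = k) (h' : ρ a.elt k = j),
        eqToHom (congrArg X.obj hk) ≫ a.map k j h' = a.map i j hj := by
      rintro k rfl h'
      simp
    exact key _ (by rw [map_one]; rfl) _
  comp_id {X Y} a := by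
    apply Hom.ext' (one_mul _)
    intro i j hi hj
    subst hj
    simp
  assoc a b c := by
    apply Hom.ext' (mul_assoc _ _ _).symm
    intro i j hi hj
    have key : ∀ k (hk : ρ b.elt (ρ a.elt i) = k) (h : ρ c.elt k = j),
        (a.map i _ rfl ≫ b.map _ _ hk) ≫ c.map k j h =
        a.map i _ rfl ≫ b.map _ _ rfl ≫ c.map _ j (by rw [hk, h]) := by
      rintro k rfl h
      simp
    exact key _ (by rw [map_mul]; rfl) _

end Wreath

end Wreath


section Crossing

variable {V : Type u} [Category.{v} V] [MonoidalCategory V]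

/-- Given `c : A ⊗ B ≅ B ⊗ A`, exchange the first two factors of `A ⊗ (B ⊗ L)`. -/
def crossing (c : ∀ A B : V, A ⊗ B ≅ B ⊗ A) (A B L : V) : A ⊗ (B ⊗ L) ≅ B ⊗ (A ⊗ L) :=
  (α_ A B L).symm ≪≫ whiskerRightIso (c A B) L ≪≫ α_ B A L

lemma crossing_natural (c : ∀ A B : V, A ⊗ B ≅ B ⊗ A)
    (hc : ∀ {A A' B B' : V} (f : A ⟶ A') (g : B ⟶ B'),
      (f ⊗ₘ g) ≫ (c A' B').hom = (c A B).hom ≫ (g ⊗ₘ f))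
    {A A' B B' L L' : V} (f : A ⟶ A') (g : B ⟶ B') (h : L ⟶ L') :
    (f ⊗ₘ (g ⊗ₘ h)) ≫ (crossing c A' B' L').hom = (crossing c A B L).hom ≫ (g ⊗ₘ (f ⊗ₘ h)) := by
  simp only [crossing, Iso.trans_hom, Iso.symm_hom, whiskerRightIso_hom, Category.assoc]
  rw [associator_inv_naturality_assoc, ← associator_naturality]
  congr 1
  rw [← tensorHom_id, ← tensorHom_id, tensorHom_comp_tensorHom_assoc,
    tensorHom_comp_tensorHom_assoc, hc]
  simp

lemma crossing_comp_crossing (c d : ∀ A B : V, A ⊗ B ≅ B ⊗ A)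
    (h : ∀ A B, (c A B).hom ≫ (d B A).hom = 𝟙 _) (A B L : V) :
    (crossing c A B L).hom ≫ (crossing d B A L).hom = 𝟙 _ := by
  simp [crossing, ← comp_whiskerRight_assoc, h]

lemma crossing_yang_baxter [BraidedCategory V] (A B C L : V) :
    (crossing (fun A B => β_ A B) A B (C ⊗ L)).hom ≫
      B ◁ (crossing (fun A B => β_ A B) A C L).hom ≫
        (crossing (fun A B => β_ A B) B C (A ⊗ L)).hom =
    A ◁ (crossing (fun A B => β_ A B) B C L).hom ≫
      (crossing (fun A B => β_ A B) A C (B ⊗ L)).hom ≫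
        C ◁ (crossing (fun A B => β_ A B) A B L).hom := by
  have := congrArg (fun t => (α_ A B (C ⊗ L)).inv ≫ (α_ (A ⊗ B) C L).inv ≫
    (α_ A B C).hom ▷ L ≫ t ▷ L ≫ (α_ C (B ⊗ A) L).hom ≫ C ◁ (α_ B A L).hom)
    (BraidedCategory.yang_baxter A B C)
  simp only [comp_whiskerRight, Category.assoc] at this
  simp only [crossing, Iso.trans_hom, Iso.symm_hom, whiskerRightIso_hom]
  convert this using 1
  · monoidal
  · monoidal

end Crossing

section Symmetric

variable {V : Type u} [Category.{v} V] [MonoidalCategory V] [SymmetricCategory V] {ι : Type w}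

/-- The symmetry coherence morphisms between iterated tensor products: those generated under
composition by exchanging two adjacent factors by means of the symmetry, at any position. -/
inductive IsPermutation (X : ι → V) :
    ∀ {l l' : List ι}, (tensorList X l ⟶ tensorList X l') → Prop
  | nil : IsPermutation X (l := []) (l' := []) (𝟙 _)
  | cons (a : ι) {l l' : List ι} {m : tensorList X l ⟶ tensorList X l'} :
      IsPermutation X m → IsPermutation X (l := a :: l) (l' := a :: l') (X a ◁ m)
  | swap (a b : ι) (l : List ι) :
      IsPermutation X (l := a :: b :: l) (l' := b :: a :: l)
        (crossing (fun A B => β_ A B) (X a) (X b) (tensorList X l)).hom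
  | comp {l l' l'' : List ι} {m : tensorList X l ⟶ tensorList X l'}
      {m' : tensorList X l' ⟶ tensorList X l''} :
      IsPermutation X m → IsPermutation X m' → IsPermutation X (m ≫ m')

namespace IsPermutation

lemma id (X : ι → V) (l : List ι) : IsPermutation X (𝟙 (tensorList X l)) := by
  induction l with
  | nil => exact nil
  | cons a l ih =>
    have := ih.cons a
    rwa [whiskerLeft_id] at this

lemma exists_of_perm (X : ι → V) {l l' : List ι} (h : l.Perm l') :
    ∃ m : tensorList X l ⟶ tensorList X l', IsPermutation X m := by
  induction h with
  | nil => exact ⟨_, nil⟩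
  | cons a _ ih => exact ⟨_, ih.choose_spec.cons a⟩
  | swap a b l => exact ⟨_, swap b a l⟩
  | trans _ _ ih ih' => exact ⟨_, ih.choose_spec.comp ih'.choose_spec⟩

/-- `Removal a l r`: the list `r` is obtained from `l` by removing one occurrence of `a`. -/
inductive Removal (a : ι) : List ι → List ι → Type w
  | head (l : List ι) : Removal a (a :: l) l
  | tail (b : ι) {l r : List ι} : Removal a l r → Removal a (b :: l) (b :: r)

lemma Removal.mem {a : ι} {l r : List ι} (R : Removal a l r) : a ∈ l := by
  induction R with
  | head l => simp
  | tail b _ ih => simp [ih]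

lemma Removal.nodup {a : ι} {l r : List ι} (R : Removal a l r) (h : l.Nodup) : r.Nodup := by
  have : r.Sublist l := by
    clear h
    induction R with
    | head l => simp
    | tail b _ ih => simp [ih]
  exact this.nodup h

lemma Removal.unique {a : ι} {l r r' : List ι} (R : Removal a l r) (R' : Removal a l r')
    (h : l.Nodup) : r = r' ∧ HEq R R' := by
  induction R generalizing r' with
  | head l =>
    cases R' with
    | head => exact ⟨rfl, HEq.rfl⟩
    | tail _ R' => exact absurd R'.mem (List.nodup_cons.1 h).1
  | tail b R ih =>
    cases R' with
    | head => exact absurd R.mem (List.nodup_cons.1 h).1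
    | tail _ R' =>
      obtain ⟨rfl, h'⟩ := ih R' (List.nodup_cons.1 h).2
      cases h'
      exact ⟨rfl, HEq.rfl⟩

/-- Move the chosen factor `X a` to the front. -/
def extract (X : ι → V) {a : ι} : ∀ {l r : List ι}, Removal a l r →
    (tensorList X l ≅ X a ⊗ tensorList X r)
  | _, _, .head l => Iso.refl (tensorList X (a :: l))
  | _, _, .tail (r := r) b R => whiskerLeftIso (X b) (extract X R) ≪≫
      crossing (fun A B => β_ A B) (X b) (X a) (tensorList X r)

lemma extract_natural_tail {A B L L' R R' : V} {m : L ⟶ L'} {e : L ≅ A ⊗ R} {e' : L' ≅ A ⊗ R'}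
    {m' : R ⟶ R'} (h : m ≫ e'.hom = e.hom ≫ A ◁ m') :
    B ◁ m ≫ (whiskerLeftIso B e' ≪≫ crossing (fun A B => β_ A B) B A R').hom =
      (whiskerLeftIso B e ≪≫ crossing (fun A B => β_ A B) B A R).hom ≫ A ◁ B ◁ m' := by
  have := crossing_natural (fun A B : V => β_ A B)
    (fun f g => BraidedCategory.braiding_naturality f g) (𝟙 B) (𝟙 A) m'
  simp only [id_tensorHom] at this
  simp only [Iso.trans_hom, whiskerLeftIso_hom, Category.assoc, ← this,
    ← whiskerLeft_comp_assoc, h]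

lemma extract_natural {X : ι → V} {l l' : List ι} {m : tensorList X l ⟶ tensorList X l'}
    (h : IsPermutation X m) {a : ι} {r : List ι} (R : Removal a l r) :
    ∃ (r' : List ι) (R' : Removal a l' r') (m' : tensorList X r ⟶ tensorList X r'),
      IsPermutation X m' ∧ m ≫ (extract X R').hom = (extract X R).hom ≫ X a ◁ m' := by
  induction h generalizing r with
  | nil => cases R
  | cons b hm ih =>
    cases R with
    | head => exact ⟨_, .head _, _, hm, (Category.comp_id _).trans (Category.id_comp _).symm⟩
    | tail _ R =>
      obtain ⟨r', R', m', hm', h'⟩ := ih R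
      exact ⟨_, .tail _ R', _, hm'.cons b, extract_natural_tail h'⟩
  | swap b c l =>
    cases R with
    | head =>
      refine ⟨_, .tail c (.head l), _, IsPermutation.id X _, ?_⟩
      have h : ∀ A B L : V, (crossing (fun A B => β_ A B) A B L).hom ≫
          (whiskerLeftIso B (Iso.refl _) ≪≫ crossing (fun A B => β_ A B) B A L).hom =
          𝟙 _ ≫ A ◁ 𝟙 _ := by
        intro A B L
        simpa using crossing_comp_crossing (fun A B : V => β_ A B) (fun A B => β_ A B)
          (fun A B => SymmetricCategory.symmetry A B) A B L
      exact h _ _ _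
    | tail _ R =>
      cases R with
      | head =>
        refine ⟨_, .head _, _, IsPermutation.id X _, ?_⟩
        have h : ∀ A B L : V, (crossing (fun A B => β_ A B) A B L).hom ≫ 𝟙 _ =
            (whiskerLeftIso A (Iso.refl _) ≪≫ crossing (fun A B => β_ A B) A B L).hom ≫
            B ◁ 𝟙 _ := by
          intro A B L
          simp
        exact h _ _ _
      | tail _ R =>
        refine ⟨_, .tail c (.tail b R), _, swap b c _, ?_⟩
        have h : ∀ {A B C L R : V} (e : L ≅ A ⊗ R), (crossing (fun A B => β_ A B) B C L).hom ≫
            (whiskerLeftIso C (whiskerLeftIso B e ≪≫ crossing (fun A B => β_ A B) B A R) ≪≫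
              crossing (fun A B => β_ A B) C A (B ⊗ R)).hom =
            (whiskerLeftIso B (whiskerLeftIso C e ≪≫ crossing (fun A B => β_ A B) C A R) ≪≫
              crossing (fun A B => β_ A B) B A (C ⊗ R)).hom ≫
            A ◁ (crossing (fun A B => β_ A B) B C R).hom := by
          intro A B C L R e
          have h₁ := crossing_natural (fun A B : V => β_ A B)
            (fun f g => BraidedCategory.braiding_naturality f g) (𝟙 B) (𝟙 C) e.hom
          have h₂ := crossing_yang_baxter B C A R
          simp only [id_tensorHom] at h₁
          simp only [Iso.trans_hom, whiskerLeftIso_hom, Category.assoc, whiskerLeft_comp]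
          rw [← h₂, reassoc_of% h₁]
        exact h _
  | comp _ _ ih ih' =>
    obtain ⟨r', R', m', hm', h'⟩ := ih R
    obtain ⟨r'', R'', m'', hm'', h''⟩ := ih' R'
    refine ⟨_, R'', _, hm'.comp hm'', ?_⟩
    rw [Category.assoc, h'', reassoc_of% h', whiskerLeft_comp]

lemma perm {X : ι → V} {l l' : List ι} {m : tensorList X l ⟶ tensorList X l'}
    (h : IsPermutation X m) : l.Perm l' := by
  induction h with
  | nil => exact .nil
  | cons a _ ih => exact ih.cons a
  | swap a b l => exact .swap b a l
  | comp _ _ ih ih' => exact ih.trans ih'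

lemma eq_id_of_nil {X : ι → V} {l l' : List ι} {m : tensorList X l ⟶ tensorList X l'}
    (h : IsPermutation X m) (hl : l = []) : HEq m (𝟙 (𝟙_ V)) := by
  induction h with
  | nil => exact HEq.rfl
  | cons => cases hl
  | swap => cases hl
  | comp h h' ih ih' =>
    subst hl
    obtain rfl := h.perm.symm.eq_nil
    obtain rfl := h'.perm.symm.eq_nil
    have e := eq_of_heq (ih rfl)
    have e' := eq_of_heq (ih' rfl)
    subst e e'
    exact heq_of_eq (Category.comp_id _)

lemma eq_of_nodup {X : ι → V} {l l' : List ι} {m m' : tensorList X l ⟶ tensorList X l'}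
    (h : IsPermutation X m) (h' : IsPermutation X m') (hl : l'.Nodup) : m = m' := by
  induction l generalizing l' with
  | nil => exact eq_of_heq ((h.eq_id_of_nil rfl).trans (h'.eq_id_of_nil rfl).symm)
  | cons a l ih =>
    obtain ⟨r, R, n, hn, e⟩ := h.extract_natural (.head l)
    obtain ⟨r', R', n', hn', e'⟩ := h'.extract_natural (.head l)
    obtain ⟨rfl, h⟩ := R.unique R' hl
    cases h
    obtain rfl := ih hn hn' (R.nodup hl)
    rw [← cancel_mono (extract X R).hom, e, e']

lemma push {X Y : ι → V} {π : Equiv.Perm ι} (f : FamilyOver π X Y) {l l' : List ι}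
    {m : tensorList X l ⟶ tensorList X l'} (h : IsPermutation X m) :
    ∃ m' : tensorList Y (l.map π) ⟶ tensorList Y (l'.map π), IsPermutation Y m' ∧
      m ≫ tensorListPush f l' = tensorListPush f l ≫ m' := by
  induction h with
  | nil => exact ⟨_, nil, rfl⟩
  | cons a _ ih =>
    obtain ⟨m', hm', e⟩ := ih
    refine ⟨_, hm'.cons (π a), ?_⟩
    have h : ∀ {A A' L L' M M' : V} {m : L ⟶ L'} {m' : M ⟶ M'} {g : A ⟶ A'} {p : L ⟶ M}
        {p' : L' ⟶ M'} (_ : m ≫ p' = p ≫ m'), A ◁ m ≫ (g ⊗ₘ p') = (g ⊗ₘ p) ≫ A' ◁ m' := by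
      intro A A' L L' M M' m m' g p p' h
      rw [← id_tensorHom, ← id_tensorHom, tensorHom_comp_tensorHom, tensorHom_comp_tensorHom, h]
      simp
    exact h e
  | swap a b l =>
    exact ⟨_, swap _ _ _, (crossing_natural (fun A B : V => β_ A B)
      (fun f g => BraidedCategory.braiding_naturality f g) _ _ _).symm⟩
  | comp _ _ ih ih' =>
    obtain ⟨m, hm, e⟩ := ih
    obtain ⟨m', hm', e'⟩ := ih'
    exact ⟨_, hm.comp hm', by rw [Category.assoc, e', reassoc_of% e]⟩

end IsPermutation

/-- The symmetry coherence morphism `X l₁ ⊗ (X l₂ ⊗ ⋯) ⟶ X l'₁ ⊗ (X l'₂ ⊗ ⋯)` for a rearrangement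
`l'` of `l`. If the indices in `l'` are distinct, it is the only morphism satisfying
`IsPermutation`: see `IsPermutation.eq_of_nodup`. -/
noncomputable def permute (X : ι → V) {l l' : List ι} (h : l.Perm l') :
    tensorList X l ⟶ tensorList X l' :=
  (IsPermutation.exists_of_perm X h).choose

lemma permute_spec (X : ι → V) {l l' : List ι} (h : l.Perm l') :
    IsPermutation X (permute X h) :=
  (IsPermutation.exists_of_perm X h).choose_spec

end Symmetric


section Diagram

variable {V : Type u} [Category.{v} V] [MonoidalCategory V] {ι : Type w}

/-- A morphism from `T` to an iterated tensor product of members of the family `X`. -/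
structure Diagram (X : ι → V) (T : V) where
  word : List ι
  hom : T ⟶ tensorList X word

namespace Diagram

variable {X Y Z : ι → V} {S T : V}

/-- Precompose with a morphism. -/
def pre (s : S ⟶ T) (D : Diagram X T) : Diagram X S := ⟨D.1, s ≫ D.2⟩

/-- Tensor on the left with `X a`. -/
def cons (a : ι) (D : Diagram X T) : Diagram X (X a ⊗ T) := ⟨a :: D.1, X a ◁ D.2⟩

/-- Postcompose with `tensorListPush`. -/
def push {π : Equiv.Perm ι} (f : FamilyOver π X Y) (D : Diagram X T) : Diagram Y T :=
  ⟨D.1.map π, D.2 ≫ tensorListPush f D.1⟩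

lemma exists_pre_cons (a : ι) (l : List ι) (u : T ⟶ tensorList X (a :: l)) :
    ∃ s : T ⟶ X a ⊗ tensorList X l,
      (⟨a :: l, u⟩ : Diagram X T) = pre s (cons a (⟨l, 𝟙 _⟩ : Diagram X (tensorList X l))) := by
  refine ⟨u, congrArg (Diagram.mk _) ?_⟩
  have h : ∀ {A L : V} (u : T ⟶ A ⊗ L), u = u ≫ A ◁ 𝟙 L := by simp
  exact h u

lemma push_pre {π : Equiv.Perm ι} (f : FamilyOver π X Y) (s : S ⟶ T) (D : Diagram X T) :
    push f (pre s D) = pre s (push f D) :=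
  congrArg (Diagram.mk _) (Category.assoc _ _ _)

lemma pre_pre {R : V} (r : R ⟶ S) (s : S ⟶ T) (D : Diagram X T) :
    pre r (pre s D) = pre (r ≫ s) D :=
  congrArg (Diagram.mk _) (Category.assoc _ _ _).symm

lemma push_cons {π : Equiv.Perm ι} (f : FamilyOver π X Y) (a : ι) (D : Diagram X T) :
    push f (cons a D) = pre (f a (π a) rfl ▷ T) (cons (π a) (push f D)) := by
  have h : ∀ {A B L M : V} (g : A ⟶ B) (p : T ⟶ L) (q : L ⟶ M),
      A ◁ p ≫ (g ⊗ₘ q) = g ▷ T ≫ B ◁ (p ≫ q) := by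
    intro A B L M g p q
    rw [← id_tensorHom, ← id_tensorHom, ← tensorHom_id, tensorHom_comp_tensorHom,
      tensorHom_comp_tensorHom]
    simp
  exact congrArg (Diagram.mk _) (h _ _ _)

lemma push_push {π γ σ : Equiv.Perm ι} (f : FamilyOver π X Y) (g : FamilyOver γ Y Z)
    (k : FamilyOver σ X Z) (hσ : ∀ i, σ i = γ (π i))
    (hk : ∀ i j hj, k i j hj = f i (π i) rfl ≫ g (π i) j ((hσ i).symm.trans hj))
    (D : Diagram X T) :
    push g (push f D) = push k D := by
  obtain ⟨l, u⟩ := D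
  induction l generalizing T with
  | nil => exact congrArg (Diagram.mk _) (congrArg (· ≫ 𝟙 _) (Category.comp_id _))
  | cons a l ih =>
    obtain ⟨s, hs⟩ := exists_pre_cons a l u
    rw [hs]
    simp only [push_pre, push_cons, ih]
    congr 1
    rw [pre_pre, ← comp_whiskerRight, ← hk a _ (hσ a)]
    generalize push k _ = E
    have : ∀ b (hb : σ a = b), pre (k a b hb ▷ _) (cons b E) =
        pre (k a (σ a) rfl ▷ _) (cons (σ a) E) := by
      rintro b rfl
      rfl
    exact this _ _

lemma push_id {σ : Equiv.Perm ι} (k : FamilyOver σ X X) (hσ : ∀ i, σ i = i)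
    (hk : ∀ i, k i i (hσ i) = 𝟙 _) (D : Diagram X T) : push k D = D := by
  obtain ⟨l, u⟩ := D
  induction l generalizing T with
  | nil => exact congrArg (Diagram.mk _) (Category.comp_id _)
  | cons a l ih =>
    obtain ⟨s, hs⟩ := exists_pre_cons a l u
    rw [hs]
    simp only [push_pre, push_cons, ih]
    congr 1
    generalize (⟨l, 𝟙 _⟩ : Diagram X _) = E
    have : ∀ b (hb : σ a = b) (hab : b = a), pre (k a b hb ▷ _) (cons b E) = cons a E := by
      rintro b hb rfl
      rw [hk]
      have h : ∀ {A L M : V} (q : L ⟶ M), 𝟙 A ▷ L ≫ A ◁ q = A ◁ q := by simp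
      exact congrArg (Diagram.mk _) (h _)
    exact this _ _ (hσ a)

lemma comp_permute_congr [SymmetricCategory V] {D D' : Diagram X T} (h : D = D') {l : List ι}
    (p : D.1.Perm l) (p' : D'.1.Perm l) : D.2 ≫ permute X p = D'.2 ≫ permute X p' := by
  subst h
  rfl

/-- Exchange the entries in positions `i` and `i + 1` (if there are such entries). -/
def swapAt : ℕ → List ι → List ι
  | 0, [] => []
  | 0, [a] => [a]
  | 0, a :: b :: l => b :: a :: l
  | _ + 1, [] => []
  | i + 1, a :: l => a :: swapAt i l

lemma length_swapAt : ∀ (i : ℕ) (l : List ι), (swapAt i l).length = l.length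
  | 0, [] => rfl
  | 0, [_] => rfl
  | 0, _ :: _ :: _ => rfl
  | _ + 1, [] => rfl
  | i + 1, _ :: l => congrArg (· + 1) (length_swapAt i l)

/-- The morphism that exchanges the factors in positions `i` and `i + 1` by means of `c`. -/
def crossingAt (c : ∀ A B : V, A ⊗ B ≅ B ⊗ A) (X : ι → V) :
    ∀ (i : ℕ) (l : List ι), tensorList X l ⟶ tensorList X (swapAt i l)
  | 0, [] => 𝟙 _
  | 0, [_] => 𝟙 _
  | 0, a :: b :: l => (crossing c (X a) (X b) (tensorList X l)).hom
  | _ + 1, [] => 𝟙 _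
  | i + 1, a :: l => X a ◁ crossingAt c X i l

/-- Postcompose with `crossingAt c X i`. -/
def step (c : ∀ A B : V, A ⊗ B ≅ B ⊗ A) (i : ℕ) (D : Diagram X T) : Diagram X T :=
  ⟨swapAt i D.1, D.2 ≫ crossingAt c X i D.1⟩

variable (c d : ∀ A B : V, A ⊗ B ≅ B ⊗ A)

lemma step_pre (i : ℕ) (s : S ⟶ T) (D : Diagram X T) :
    step c i (pre s D) = pre s (step c i D) :=
  congrArg (Diagram.mk _) (Category.assoc _ _ _)

lemma step_cons (i : ℕ) (a : ι) (D : Diagram X T) :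
    step c (i + 1) (cons a D) = cons a (step c i D) :=
  congrArg (Diagram.mk _) (whiskerLeft_comp _ _ _).symm

lemma step_step (h : ∀ A B, (c A B).hom ≫ (d B A).hom = 𝟙 _) (i : ℕ) (D : Diagram X T) :
    step d i (step c i D) = D := by
  obtain ⟨l, u⟩ := D
  have triv : ∀ {T L : V} (u : T ⟶ L), (u ≫ 𝟙 _) ≫ 𝟙 _ = u := by simp
  induction i generalizing T l with
  | zero =>
    match l, u with
    | [], u => exact congrArg (Diagram.mk _) (triv _)
    | [a], u => exact congrArg (Diagram.mk _) (triv _)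
    | a :: b :: l, u =>
      have : ∀ {A B L : V} (u : T ⟶ A ⊗ B ⊗ L),
          (u ≫ (crossing c A B L).hom) ≫ (crossing d B A L).hom = u := by
        intro A B L u
        rw [Category.assoc, crossing_comp_crossing c d h, Category.comp_id]
      exact congrArg (Diagram.mk _) (this _)
  | succ i ih =>
    match l, u with
    | [], u => exact congrArg (Diagram.mk _) (triv _)
    | a :: l, u =>
      obtain ⟨s, hs⟩ := exists_pre_cons a l u
      rw [hs]
      simp only [step_pre, step_cons]
      rw [ih]

lemma step_push {π : Equiv.Perm ι} (f : FamilyOver π X Y)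
    (hc : ∀ {A A' B B' : V} (f : A ⟶ A') (g : B ⟶ B'),
      (f ⊗ₘ g) ≫ (c A' B').hom = (c A B).hom ≫ (g ⊗ₘ f)) (i : ℕ) (D : Diagram X T) :
    step c i (push f D) = push f (step c i D) := by
  obtain ⟨l, u⟩ := D
  induction i generalizing T l with
  | zero =>
    match l, u with
    | [], u => rfl
    | [a], u =>
      have : ∀ {L M : V} (u : T ⟶ L) (f : L ⟶ M), (u ≫ f) ≫ 𝟙 _ = (u ≫ 𝟙 _) ≫ f := by simp
      exact congrArg (Diagram.mk _) (this u _)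
    | a :: b :: l, u =>
      have h : ∀ {A A' B B' L L' : V} (u : T ⟶ A ⊗ (B ⊗ L)) (f : A ⟶ A') (g : B ⟶ B')
          (h : L ⟶ L'), (u ≫ (f ⊗ₘ (g ⊗ₘ h))) ≫ (crossing c A' B' L').hom =
          (u ≫ (crossing c A B L).hom) ≫ (g ⊗ₘ (f ⊗ₘ h)) := by
        intros
        simp [crossing_natural c hc _ _ _]
      exact congrArg (Diagram.mk _) (h u _ _ _)
  | succ i ih =>
    match l, u with
    | [], u => rfl
    | a :: l, u =>
      obtain ⟨s, hs⟩ := exists_pre_cons a l u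
      rw [hs]
      simp only [step_pre, push_pre, step_cons, push_cons, ih]

lemma step_far (hc : ∀ {A A' B B' : V} (f : A ⟶ A') (g : B ⟶ B'),
      (f ⊗ₘ g) ≫ (c A' B').hom = (c A B).hom ≫ (g ⊗ₘ f)) (i j : ℕ) (hij : i + 2 ≤ j)
    (D : Diagram X T) : step c i (step c j D) = step c j (step c i D) := by
  obtain ⟨l, u⟩ := D
  induction i generalizing T l j with
  | zero =>
    obtain ⟨j, rfl⟩ : ∃ k, j = k + 2 := ⟨j - 2, by omega⟩
    match l, u with
    | [], u => rfl
    | [a], u =>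
      have : ∀ {L M : V} (u : T ⟶ L) (f : L ⟶ M), (u ≫ f) ≫ 𝟙 _ = (u ≫ 𝟙 _) ≫ f := by simp
      exact congrArg (Diagram.mk _) (this u _)
    | a :: b :: l, u =>
      have h : ∀ {A B L L' : V} (u : T ⟶ A ⊗ (B ⊗ L)) (h : L ⟶ L'),
          (u ≫ (A ◁ B ◁ h)) ≫ (crossing c A B L').hom =
          (u ≫ (crossing c A B L).hom) ≫ (B ◁ A ◁ h) := by
        intro A B L L' u h
        have := crossing_natural c hc (𝟙 A) (𝟙 B) h
        simp only [id_tensorHom] at this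
        simp [this]
      exact congrArg (Diagram.mk _) (h u _)
  | succ i ih =>
    obtain ⟨j, rfl⟩ : ∃ k, j = k + 1 := ⟨j - 1, by omega⟩
    match l, u with
    | [], u => rfl
    | a :: l, u =>
      obtain ⟨s, hs⟩ := exists_pre_cons a l u
      rw [hs]
      simp only [step_pre, step_cons, ih j (by omega)]

lemma step_yang_baxter [BraidedCategory V] (i : ℕ) (D : Diagram X T) (h : i + 2 < D.1.length) :
    step (fun A B => β_ A B) i (step (fun A B => β_ A B) (i + 1)
      (step (fun A B => β_ A B) i D)) =
    step (fun A B => β_ A B) (i + 1) (step (fun A B => β_ A B) i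
      (step (fun A B => β_ A B) (i + 1) D)) := by
  obtain ⟨l, u⟩ := D
  induction i generalizing T l with
  | zero =>
    match l, u, h with
    | a :: b :: e :: l, u, h =>
      have h : ∀ {A B C L : V} (u : T ⟶ A ⊗ (B ⊗ (C ⊗ L))),
          ((u ≫ (crossing (fun A B => β_ A B) A B (C ⊗ L)).hom) ≫
          B ◁ (crossing (fun A B => β_ A B) A C L).hom) ≫
            (crossing (fun A B => β_ A B) B C (A ⊗ L)).hom =
          ((u ≫ A ◁ (crossing (fun A B => β_ A B) B C L).hom) ≫
            (crossing (fun A B => β_ A B) A C (B ⊗ L)).hom) ≫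
              C ◁ (crossing (fun A B => β_ A B) A B L).hom := by
        intro A B C L u
        simp only [Category.assoc, crossing_yang_baxter A B C L]
      exact congrArg (Diagram.mk _) (h u)
  | succ i ih =>
    match l, u, h with
    | a :: l, u, h =>
      have ih' := ih l (𝟙 _) (Nat.lt_of_succ_lt_succ h)
      obtain ⟨s, hs⟩ := exists_pre_cons a l u
      rw [hs]
      simp only [step_pre, step_cons, ih']

end Diagram

end Diagram

section Braid

/-- The Artin relations on `σ₀, …, σₙ₋₂`: `σᵢ σⱼ σᵢ = σⱼ σᵢ σⱼ` for `j = i + 1`, and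
`σᵢ σⱼ = σⱼ σᵢ` for `j ≥ i + 2`. -/
def braidRels (n : ℕ) : Set (FreeGroup (Fin (n - 1))) :=
  {r | (∃ i j : Fin (n - 1), i.val + 1 = j.val ∧
      r = .of i * .of j * .of i * (.of j * .of i * .of j)⁻¹) ∨
    (∃ i j : Fin (n - 1), i.val + 2 ≤ j.val ∧ r = .of i * .of j * (.of j * .of i)⁻¹)}

/-- The braid group on `n` strands (Artin's presentation). -/
abbrev BraidGroup (n : ℕ) := PresentedGroup (braidRels n)

lemma braid_toGroup_aux {n : ℕ} {G : Type*} [Group G] (s : Fin (n - 1) → G)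
    (h₁ : ∀ i j : Fin (n - 1), i.val + 1 = j.val → s i * s j * s i = s j * s i * s j)
    (h₂ : ∀ i j : Fin (n - 1), i.val + 2 ≤ j.val → s i * s j = s j * s i) :
    ∀ r ∈ braidRels n, FreeGroup.lift s r = 1 := by
  rintro r (⟨i, j, h, rfl⟩ | ⟨i, j, h, rfl⟩)
  · simp only [map_mul, map_inv, FreeGroup.lift_apply_of]
    rw [h₁ i j h, mul_inv_cancel]
  · simp only [map_mul, map_inv, FreeGroup.lift_apply_of]
    rw [h₂ i j h, mul_inv_cancel]

/-- The transposition of `i` and `i + 1`. -/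
def adjacentSwap (n : ℕ) (i : Fin (n - 1)) : Equiv.Perm (Fin n) :=
  Equiv.swap ⟨i.val, by omega⟩ ⟨i.val + 1, by omega⟩

/-- The underlying permutation of a braid. -/
def braidPerm (n : ℕ) : BraidGroup n →* Equiv.Perm (Fin n) :=
  PresentedGroup.toGroup (f := adjacentSwap n) <| braid_toGroup_aux _
    (by
      rintro ⟨i, hi⟩ ⟨j, hj⟩ h
      obtain rfl : i + 1 = j := h
      have h₁ : (⟨i, by omega⟩ : Fin n) ≠ ⟨i + 1, by omega⟩ := by simp
      have h₂ : (⟨i, by omega⟩ : Fin n) ≠ ⟨i + 1 + 1, by omega⟩ := by simp; omega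
      have h₃ : (⟨i + 1, by omega⟩ : Fin n) ≠ ⟨i + 1 + 1, by omega⟩ := by simp
      simp only [adjacentSwap]
      have key : ∀ x y z : Fin n, x ≠ y → x ≠ z → y ≠ z → Equiv.swap x y * Equiv.swap y z *
          Equiv.swap x y = Equiv.swap y z * Equiv.swap x y * Equiv.swap y z := by
        intro x y z h₁ h₂ h₃
        rw [Equiv.swap_mul_swap_mul_swap h₁ h₂, Equiv.swap_comm z x,
          ← Equiv.swap_mul_swap_mul_swap h₃.symm h₂.symm, Equiv.swap_comm y x,
          Equiv.swap_comm z y]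
      exact key _ _ _ h₁ h₂ h₃)
    (by
      rintro ⟨i, hi⟩ ⟨j, hj⟩ h
      have h : i + 2 ≤ j := h
      simp only [adjacentSwap]
      apply Equiv.Perm.Disjoint.commute
      rw [Equiv.Perm.disjoint_iff_disjoint_support, Equiv.Perm.support_swap (by simp),
        Equiv.Perm.support_swap (by simp)]
      simp
      omega)

lemma braidPerm_of {n : ℕ} (i : Fin (n - 1)) :
    braidPerm n (.of i) = adjacentSwap n i := PresentedGroup.toGroup.of _

lemma braid_induction {n : ℕ} {P : BraidGroup n → Prop} (one : P 1)
    (of : ∀ i, P (.of i)) (inv_of : ∀ i, P (.of i)⁻¹) (mul : ∀ a b, P a → P b → P (a * b))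
    (b : BraidGroup n) : P b := by
  induction b using PresentedGroup.induction_on with
  | H z =>
    induction z using FreeGroup.induction_on with
    | C1 => exact one
    | of i => exact of i
    | inv_of i _ => exact inv_of i
    | mul a b ha hb => exact mul _ _ ha hb

variable {V : Type u} [Category.{v} V] [MonoidalCategory V] [BraidedCategory V]

/-- The braiding `A ⊗ B ≅ B ⊗ A`. -/
abbrev posBraiding (V : Type u) [Category.{v} V] [MonoidalCategory V] [BraidedCategory V]
    (A B : V) : A ⊗ B ≅ B ⊗ A := β_ A B

/-- The inverse braiding `A ⊗ B ≅ B ⊗ A`, that is, the inverse of `β_ B A`. -/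
abbrev negBraiding (V : Type u) [Category.{v} V] [MonoidalCategory V] [BraidedCategory V]
    (A B : V) : A ⊗ B ≅ B ⊗ A := (β_ B A).symm

lemma posBraiding_natural {A A' B B' : V} (f : A ⟶ A') (g : B ⟶ B') :
    (f ⊗ₘ g) ≫ (posBraiding V A' B').hom = (posBraiding V A B).hom ≫ (g ⊗ₘ f) :=
  BraidedCategory.braiding_naturality f g

lemma negBraiding_natural {A A' B B' : V} (f : A ⟶ A') (g : B ⟶ B') :
    (f ⊗ₘ g) ≫ (negBraiding V A' B').hom = (negBraiding V A B).hom ≫ (g ⊗ₘ f) := by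
  simp

variable {ι : Type w} (n : ℕ)

/-- Postcomposition with the braiding of the factors in positions `i` and `i + 1`, as a permutation of
the morphisms from `T` to the `n`-fold tensor products of members of `X`. -/
def crossingPerm (X : ι → V) (T : V) (i : ℕ) :
    Equiv.Perm {D : Diagram X T // D.word.length = n} where
  toFun D := ⟨D.1.step (posBraiding V) i, (Diagram.length_swapAt i _).trans D.2⟩
  invFun D := ⟨D.1.step (negBraiding V) i, (Diagram.length_swapAt i _).trans D.2⟩
  left_inv D := Subtype.ext (Diagram.step_step _ _ (by simp) i D.1)
  right_inv D := Subtype.ext (Diagram.step_step _ _ (by simp) i D.1)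

/-- The action of the braid group on the morphisms from `T` to the `n`-fold tensor products of members
of `X`: the generator `σᵢ` acts by postcomposition with the braiding of the factors in positions `i`
and `i + 1`. -/
def braidAction (X : ι → V) (T : V) :
    BraidGroup n →* Equiv.Perm {D : Diagram X T // D.word.length = n} :=
  PresentedGroup.toGroup (f := fun i => crossingPerm n X T i.val) <| braid_toGroup_aux _
    (by
      rintro ⟨i, hi⟩ ⟨j, hj⟩ h
      obtain rfl : i + 1 = j := h
      ext1 D
      exact Subtype.ext (Diagram.step_yang_baxter i D.1 (by rw [D.2]; omega)))
    (by
      rintro ⟨i, hi⟩ ⟨j, hj⟩ h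
      ext1 D
      exact Subtype.ext (Diagram.step_far _ posBraiding_natural i j h D.1))

variable {n}

lemma braidAction_of (X : ι → V) (T : V) (i : Fin (n - 1)) :
    braidAction n X T (.of i) = crossingPerm n X T i.val := PresentedGroup.toGroup.of _

lemma braidAction_pre {X : ι → V} {S T : V} (s : S ⟶ T) (b : BraidGroup n) :
    ∀ D : {D : Diagram X T // D.word.length = n},
      braidAction n X S b ⟨D.1.pre s, D.2⟩ =
        ⟨(braidAction n X T b D).1.pre s, (braidAction n X T b D).2⟩ := by
  induction b using braid_induction with
  | one => intro D; simp
  | of i =>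
    intro D
    rw [braidAction_of, braidAction_of]
    exact Subtype.ext (Diagram.step_pre _ _ _ _)
  | inv_of i =>
    intro D
    rw [map_inv, map_inv, braidAction_of, braidAction_of]
    exact Subtype.ext (Diagram.step_pre _ _ _ _)
  | mul a b ha hb =>
    intro D
    rw [map_mul, map_mul, Equiv.Perm.mul_apply, Equiv.Perm.mul_apply, hb, ha]

lemma braidAction_push {X Y : ι → V} {T : V} {π : Equiv.Perm ι} (f : FamilyOver π X Y)
    (b : BraidGroup n) :
    ∀ D : {D : Diagram X T // D.word.length = n},
      braidAction n Y T b ⟨D.1.push f, (List.length_map _).trans D.2⟩ =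
        ⟨(braidAction n X T b D).1.push f,
          (List.length_map _).trans (braidAction n X T b D).2⟩ := by
  induction b using braid_induction with
  | one => intro D; simp
  | of i =>
    intro D
    rw [braidAction_of, braidAction_of]
    exact Subtype.ext (Diagram.step_push _ _ posBraiding_natural _ _)
  | inv_of i =>
    intro D
    rw [map_inv, map_inv, braidAction_of, braidAction_of]
    exact Subtype.ext (Diagram.step_push _ _ negBraiding_natural _ _)
  | mul a b ha hb =>
    intro D
    rw [map_mul, map_mul, Equiv.Perm.mul_apply, Equiv.Perm.mul_apply, hb, ha]

lemma getElem?_swapAt (i : ℕ) (l : List ι) (h : i + 1 < l.length) (k : ℕ) :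
    (Diagram.swapAt i l)[k]? = l[if k = i then i + 1 else if k = i + 1 then i else k]? := by
  induction i generalizing l k with
  | zero =>
    match l, h with
    | a :: b :: l, h =>
      match k with
      | 0 => rfl
      | 1 => rfl
      | k + 2 => rfl
  | succ i ih =>
    match l, h with
    | a :: l, h =>
      match k with
      | 0 => simp [Diagram.swapAt]
      | k + 1 =>
        have := ih l (Nat.lt_of_succ_lt_succ h) k
        simp only [Diagram.swapAt, List.getElem?_cons_succ, this, Nat.add_right_cancel_iff]
        split_ifs <;> simp

lemma swapAt_ofFn (i : Fin (n - 1)) (p : Fin n → ι) :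
    Diagram.swapAt i.val (List.ofFn p) = List.ofFn (p ∘ adjacentSwap n i) := by
  apply List.ext_getElem?
  intro k
  rw [getElem?_swapAt _ _ (by simp; omega)]
  simp only [List.getElem?_ofFn, Function.comp, adjacentSwap]
  by_cases hk : k < n
  · rw [dif_pos hk]
    split_ifs <;> first | omega | skip
    all_goals congr 2
    all_goals simp_all [Equiv.swap_apply_def]
  · have h₁ := i.2
    rw [if_neg (by omega), if_neg (by omega), dif_neg hk, dif_neg hk]

lemma braidAction_word {X : ι → V} {T : V} (b : BraidGroup n) :
    ∀ (D : {D : Diagram X T // D.word.length = n}) (p : Fin n → ι), D.1.word = List.ofFn p →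
      (braidAction n X T b D).1.word = List.ofFn (p ∘ ⇑(braidPerm n b)⁻¹) := by
  induction b using braid_induction with
  | one => intro D p h; simpa using h
  | of i =>
    intro D p h
    rw [braidAction_of, braidPerm_of]
    change Diagram.swapAt i.val D.1.word = _
    rw [h, swapAt_ofFn]
    simp [adjacentSwap]
  | inv_of i =>
    intro D p h
    rw [map_inv, map_inv, braidAction_of, braidPerm_of]
    change Diagram.swapAt i.val D.1.word = _
    rw [h, swapAt_ofFn]
    simp
  | mul a b ha hb =>
    intro D p h
    rw [map_mul, map_mul, Equiv.Perm.mul_apply, ha _ _ (hb _ _ h)]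
    simp [Function.comp_assoc]

end Braid

section Free

/-- The value at `V` of the 2-monad for monoidal categories: objects are finite sequences of
objects of `V`, and morphisms are the sequences of morphisms of `V` (of equal length). -/
abbrev FreeMonoidal (V : Type u) := Σ n : ℕ, (Fin n → V)

/-- The value at `V` of the 2-monad for symmetric monoidal categories: objects are finite sequences
of objects of `V`, and a morphism `(X₁, …, Xₙ) ⟶ (Y₁, …, Yₙ)` is a permutation `ρ` of `n` letters with
morphisms `Xᵢ ⟶ Y_{ρ i}`. -/
abbrev FreeSymmetric (V : Type u) := Σ n : ℕ, Wreath (MonoidHom.id (Equiv.Perm (Fin n))) V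

/-- The value at `V` of the 2-monad for braided monoidal categories: objects are finite sequences
of objects of `V`, and a morphism `(X₁, …, Xₙ) ⟶ (Y₁, …, Yₙ)` is a braid `b` on `n` strands with
morphisms `Xᵢ ⟶ Y_{ρ i}`, where `ρ` is the underlying permutation of `b`. -/
abbrev FreeBraided (V : Type u) := Σ n : ℕ, Wreath (braidPerm n) V

variable {V : Type u₁} [Category.{v₁} V] {W : Type u₂} [Category.{v₂} W]

/-- Apply a functor to each entry of a sequence of objects. -/
@[simps]
def piMap (n : ℕ) (F : V ⥤ W) : (Fin n → V) ⥤ (Fin n → W) where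
  obj X := fun i => F.obj (X i)
  map f := fun i => F.map (f i)

/-- Apply a functor to each entry of a sequence of objects. -/
@[simps]
def Wreath.mapFunctor {n : ℕ} {G : Type} [Group G] (ρ : G →* Equiv.Perm (Fin n)) (F : V ⥤ W) :
    Wreath ρ V ⥤ Wreath ρ W where
  obj X := ⟨fun i => F.obj (X.obj i)⟩
  map f := ⟨f.elt, fun i j h => F.map (f.map i j h)⟩
  map_id X := by
    refine Wreath.Hom.ext' ?_ ?_
    · rfl
    intro i j h _
    have e : i = j := by
      rw [← h]
      change i = ρ 1 i
      simp
    exact eqToHom_map F (congrArg X.obj e)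
  map_comp f g := by
    refine Wreath.Hom.ext' ?_ ?_
    · rfl
    intro i j _ _
    exact F.map_comp _ _

/-- The 2-monad for monoidal categories, on functors. -/
def FreeMonoidal.map (F : V ⥤ W) : FreeMonoidal V ⥤ FreeMonoidal W :=
  Sigma.desc fun n => piMap n F ⋙ Sigma.incl (C := fun n : ℕ => Fin n → W) n

/-- The 2-monad for symmetric monoidal categories, on functors. -/
def FreeSymmetric.map (F : V ⥤ W) : FreeSymmetric V ⥤ FreeSymmetric W :=
  Sigma.desc fun n => Wreath.mapFunctor (MonoidHom.id (Equiv.Perm (Fin n))) F ⋙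
    Sigma.incl (C := fun n : ℕ => Wreath (MonoidHom.id (Equiv.Perm (Fin n))) W) n

/-- The 2-monad for braided monoidal categories, on functors. -/
def FreeBraided.map (F : V ⥤ W) : FreeBraided V ⥤ FreeBraided W :=
  Sigma.desc fun n => Wreath.mapFunctor (braidPerm n) F ⋙
    Sigma.incl (C := fun n : ℕ => Wreath (braidPerm n) W) n

end Free

section Tensor

variable {V : Type u} [Category.{v} V] [MonoidalCategory V] {n : ℕ}

/-- The `n`-fold tensor product `X₁ ⊗ (X₂ ⊗ (⋯ ⊗ (Xₙ ⊗ 𝟙_ V)))` as a functor of `n` variables. -/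
def tensorPi (V : Type u) [Category.{v} V] [MonoidalCategory V] (n : ℕ) : (Fin n → V) ⥤ V where
  obj X := tensorList X (List.finRange n)
  map f := tensorListHom f (List.finRange n)
  map_id X := tensorListHom_id X _
  map_comp f g := tensorListHom_comp f g _

/-- The `n`-fold tensor product in a symmetric monoidal category: a permutation `ρ` with morphisms
`fᵢ : Xᵢ ⟶ Y_{ρ i}` is sent to the composite
`⨂ᵢ Xᵢ ⟶ ⨂ᵢ Y_{ρ i} ⟶ ⨂ⱼ Yⱼ` of the tensor product of the `fᵢ` and the symmetry coherence. -/
noncomputable def tensorSymmetric (V : Type u) [Category.{v} V] [MonoidalCategory V]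
    [SymmetricCategory V] (n : ℕ) : Wreath (MonoidHom.id (Equiv.Perm (Fin n))) V ⥤ V where
  obj X := tensorList X.obj (List.finRange n)
  map {X Y} f := tensorListPush f.map (List.finRange n) ≫
    permute Y.obj (Equiv.Perm.map_finRange_perm f.elt)
  map_id X := by
    have h := Diagram.push_id (Wreath.Hom.map (𝟙 X)) (fun _ => rfl) (fun _ => rfl)
      ⟨List.finRange n, 𝟙 _⟩
    have := Diagram.comp_permute_congr h (Equiv.Perm.map_finRange_perm _) (List.Perm.refl _)
    simp only [Diagram.push, Category.id_comp] at this
    refine this.trans ?_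
    exact (permute_spec _ _).eq_of_nodup (IsPermutation.id _ _) (List.nodup_finRange n)
  map_comp {X Y Z} f g := by
    have h := Diagram.push_push f.map g.map (Wreath.Hom.map (f ≫ g)) (fun _ => rfl)
      (fun _ _ _ => rfl) ⟨List.finRange n, 𝟙 _⟩
    have p := Equiv.Perm.map_finRange_perm f.elt
    have q := Equiv.Perm.map_finRange_perm g.elt
    have := Diagram.comp_permute_congr h ((p.map g.elt).trans q)
      (Equiv.Perm.map_finRange_perm _)
    simp only [Diagram.push, Category.id_comp] at this
    refine this.symm.trans ?_
    obtain ⟨m, hm, e⟩ := (permute_spec Y.obj p).push g.map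
    simp only [Category.assoc]
    rw [reassoc_of% e]
    congr 2
    exact (permute_spec _ _).eq_of_nodup (hm.comp (permute_spec _ _)) (List.nodup_finRange n)

lemma Diagram.eq_mk {ι : Type w} {X : ι → V} {T : V} (D : Diagram X T) {l : List ι}
    (h : D.word = l) : D = ⟨l, D.hom ≫ eqToHom (congrArg (tensorList X) h)⟩ := by
  subst h
  exact congrArg (Diagram.mk _) (Category.comp_id _).symm

section Braided

variable [BraidedCategory V]

/-- The tensor product `⨂ᵢ Xᵢ ⟶ ⨂ᵢ Y_{ρ i}` of the components of a morphism of `Wreath`. -/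
def Wreath.Hom.diagram {X Y : Wreath (braidPerm n) V} (f : Wreath.Hom X Y) :
    {D : Diagram Y.obj (tensorList X.obj (List.finRange n)) // D.word.length = n} :=
  ⟨⟨(List.finRange n).map (braidPerm n f.elt), tensorListPush f.map (List.finRange n)⟩, by simp⟩

lemma word_braidAction_diagram {X Y : Wreath (braidPerm n) V} (f : Wreath.Hom X Y) :
    (braidAction n _ _ f.elt f.diagram).1.word = List.finRange n := by
  rw [braidAction_word f.elt f.diagram (braidPerm n f.elt)
    (by rw [List.ofFn_eq_map]; rfl), List.finRange]
  congr 1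
  funext i
  simp

/-- The composite `⨂ᵢ Xᵢ ⟶ ⨂ᵢ Y_{ρ i} ⟶ ⨂ⱼ Yⱼ` of the tensor product of the components `fᵢ` with the
braiding morphism of the braid. (The last map is an identity: the braid takes the sequence
`Y_{ρ 1}, …, Y_{ρ n}` to `Y₁, …, Yₙ`.) -/
def braidedTensorMap {X Y : Wreath (braidPerm n) V} (f : Wreath.Hom X Y) :
    tensorList X.obj (List.finRange n) ⟶ tensorList Y.obj (List.finRange n) :=
  (braidAction n _ _ f.elt f.diagram).1.hom ≫
    eqToHom (congrArg (tensorList Y.obj) (word_braidAction_diagram f))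

lemma braidAction_diagram {X Y : Wreath (braidPerm n) V} (f : Wreath.Hom X Y) :
    braidAction n _ _ f.elt f.diagram =
      ⟨⟨List.finRange n, braidedTensorMap f⟩, List.length_finRange⟩ :=
  Subtype.ext (Diagram.eq_mk _ (word_braidAction_diagram f))

lemma braidedTensorMap_eq {X Y : Wreath (braidPerm n) V} (f : Wreath.Hom X Y)
    {m : tensorList X.obj (List.finRange n) ⟶ tensorList Y.obj (List.finRange n)}
    (h : braidAction n _ _ f.elt f.diagram = ⟨⟨List.finRange n, m⟩, List.length_finRange⟩) :
    braidedTensorMap f = m := by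
  rw [braidAction_diagram] at h
  simpa using h

/-- The `n`-fold tensor product in a braided monoidal category: a braid with underlying permutation `ρ`
and morphisms `fᵢ : Xᵢ ⟶ Y_{ρ i}` is sent to `⨂ᵢ Xᵢ ⟶ ⨂ᵢ Y_{ρ i} ⟶ ⨂ⱼ Yⱼ`. -/
def tensorBraided (V : Type u) [Category.{v} V] [MonoidalCategory V] [BraidedCategory V] (n : ℕ) :
    Wreath (braidPerm n) V ⥤ V where
  obj X := tensorList X.obj (List.finRange n)
  map f := braidedTensorMap f
  map_id X := by
    apply braidedTensorMap_eq
    have h := Diagram.push_id (Wreath.Hom.map (𝟙 X)) (fun i => by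
      change braidPerm n 1 i = i
      simp) (fun _ => rfl) ⟨List.finRange n, 𝟙 _⟩
    have e : Wreath.Hom.elt (𝟙 X) = 1 := rfl
    rw [e, map_one]
    apply Subtype.ext
    refine Eq.trans ?_ h
    exact congrArg (Diagram.mk _) (Category.id_comp _).symm
  map_comp {X Y Z} f g := by
    apply braidedTensorMap_eq
    have e : Wreath.Hom.elt (f ≫ g) = g.elt * f.elt := rfl
    have h := Diagram.push_push f.map g.map (Wreath.Hom.map (f ≫ g)) (fun i => by
      rw [e, map_mul]; rfl) (fun _ _ _ => rfl) ⟨List.finRange n, 𝟙 _⟩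
    have h' : Wreath.Hom.diagram (f ≫ g) =
        ⟨f.diagram.1.push g.map, (List.length_map _).trans f.diagram.2⟩ := by
      apply Subtype.ext
      refine Eq.trans ?_ (h.symm.trans ?_)
      · exact congrArg (Diagram.mk _) (Category.id_comp _).symm
      · refine congrArg (fun D => Diagram.push g.map D) ?_
        exact congrArg (Diagram.mk _) (Category.id_comp _)
    rw [h', e, map_mul, Equiv.Perm.mul_apply, braidAction_push, braidAction_diagram f]
    have h₂ := braidAction_pre (n := n) (braidedTensorMap f) g.elt g.diagram
    rw [braidAction_diagram g] at h₂
    exact h₂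

end Braided

end Tensor

section Oplax

open Functor.OplaxMonoidal

variable {V : Type u₁} [Category.{v₁} V] [MonoidalCategory V]
  {W : Type u₂} [Category.{v₂} W] [MonoidalCategory W]

/-- The iterated comparison `F (X₁ ⊗ (⋯ ⊗ (Xₙ ⊗ 𝟙_ V))) ⟶ F X₁ ⊗ (⋯ ⊗ (F Xₙ ⊗ 𝟙_ W))` of an oplax
(that is, colax) monoidal functor. -/
def oplaxList (F : V ⥤ W) [F.OplaxMonoidal] {ι : Type w} (X : ι → V) :
    ∀ l : List ι, F.obj (tensorList X l) ⟶ tensorList (fun i => F.obj (X i)) l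
  | [] => η F
  | a :: l => δ F (X a) (tensorList X l) ≫ F.obj (X a) ◁ oplaxList F X l

variable (F : V ⥤ W) [F.OplaxMonoidal] {ι : Type w} {X Y : ι → V}

lemma oplax_tensorHom {A A' L L' : V} {M M' : W} (f : A ⟶ A') (g : L ⟶ L') (d : F.obj L ⟶ M)
    (d' : F.obj L' ⟶ M') (g' : M ⟶ M') (h : F.map g ≫ d' = d ≫ g') :
    F.map (f ⊗ₘ g) ≫ δ F A' L' ≫ F.obj A' ◁ d' = (δ F A L ≫ F.obj A ◁ d) ≫ (F.map f ⊗ₘ g') := by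
  rw [← δ_natural_assoc, ← id_tensorHom, tensorHom_comp_tensorHom, h, Category.assoc,
    ← id_tensorHom, tensorHom_comp_tensorHom]
  simp

lemma oplaxList_tensorListHom (f : ∀ i, X i ⟶ Y i) (l : List ι) :
    F.map (tensorListHom f l) ≫ oplaxList F Y l =
      oplaxList F X l ≫ tensorListHom (fun i => F.map (f i)) l := by
  induction l with
  | nil =>
    have : F.map (𝟙 (𝟙_ V)) ≫ η F = η F ≫ 𝟙 _ := by simp
    exact this
  | cons a l ih => exact oplax_tensorHom F _ _ _ _ _ ih

lemma oplaxList_tensorListPush {π : Equiv.Perm ι} (f : FamilyOver π X Y) (l : List ι) :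
    F.map (tensorListPush f l) ≫ oplaxList F Y (l.map π) =
      oplaxList F X l ≫ tensorListPush (X := fun i => F.obj (X i)) (Y := fun i => F.obj (Y i))
        (fun i j h => F.map (f i j h)) l := by
  induction l with
  | nil =>
    have : F.map (𝟙 (𝟙_ V)) ≫ η F = η F ≫ 𝟙 _ := by simp
    exact this
  | cons a l ih => exact oplax_tensorHom F _ _ _ _ _ ih

lemma oplax_crossing (c : ∀ A B : V, A ⊗ B ≅ B ⊗ A) (c' : ∀ A B : W, A ⊗ B ≅ B ⊗ A)
    (h : ∀ A B, F.map (c A B).hom ≫ δ F B A = δ F A B ≫ (c' (F.obj A) (F.obj B)).hom)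
    (hc : ∀ {A A' B B' : W} (f : A ⟶ A') (g : B ⟶ B'),
      (f ⊗ₘ g) ≫ (c' A' B').hom = (c' A B).hom ≫ (g ⊗ₘ f))
    (A B L : V) {M : W} (d : F.obj L ⟶ M) :
    F.map (crossing c A B L).hom ≫ δ F B (A ⊗ L) ≫ F.obj B ◁ (δ F A L ≫ F.obj A ◁ d) =
      (δ F A (B ⊗ L) ≫ F.obj A ◁ (δ F B L ≫ F.obj B ◁ d)) ≫
        (crossing c' (F.obj A) (F.obj B) M).hom := by
  have h₁ := crossing_natural c' hc (𝟙 (F.obj A)) (𝟙 (F.obj B)) d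
  simp only [id_tensorHom] at h₁
  simp only [whiskerLeft_comp, Category.assoc]
  rw [h₁]
  simp only [← Category.assoc]
  congr 1
  have a₁ := oplax_associativity F A B L
  have a₂ := oplax_associativity F B A L
  simp only [crossing, Iso.trans_hom, Iso.symm_hom, whiskerRightIso_hom, F.map_comp,
    Category.assoc]
  rw [← a₂, ← δ_natural_left_assoc, ← comp_whiskerRight_assoc, h]
  simp only [comp_whiskerRight, Category.assoc]
  have a₁' : δ F A (B ⊗ L) ≫ F.obj A ◁ δ F B L ≫ (α_ (F.obj A) (F.obj B) (F.obj L)).inv =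
      F.map (α_ A B L).inv ≫ δ F (A ⊗ B) L ≫ δ F A B ▷ F.obj L := by
    rw [← cancel_epi (F.map (α_ A B L).hom), ← reassoc_of% a₁]
    simp [← F.map_comp_assoc]
  rw [reassoc_of% a₁']

/-- A colax monoidal functor between braided monoidal categories is braided when its comparison maps
commute with the braidings. Between symmetric monoidal categories this is the notion of a symmetric
colax monoidal functor. -/
class OplaxBraided [BraidedCategory V] [BraidedCategory W] (F : V ⥤ W) [F.OplaxMonoidal] :
    Prop where
  braided : ∀ A B : V, F.map (β_ A B).hom ≫ δ F B A = δ F A B ≫ (β_ (F.obj A) (F.obj B)).hom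

lemma oplax_negBraiding [BraidedCategory V] [BraidedCategory W] [OplaxBraided F] (A B : V) :
    F.map (negBraiding V A B).hom ≫ δ F B A =
      δ F A B ≫ (negBraiding W (F.obj A) (F.obj B)).hom := by
  have := OplaxBraided.braided (F := F) B A
  simp only [Iso.symm_hom]
  rw [← cancel_epi (F.map (β_ B A).hom), ← F.map_comp_assoc, reassoc_of% this]
  simp

lemma IsPermutation.oplax [SymmetricCategory V] [SymmetricCategory W] [OplaxBraided F]
    {l l' : List ι} {m : tensorList X l ⟶ tensorList X l'} (h : IsPermutation X m) :
    ∃ m' : tensorList (fun i => F.obj (X i)) l ⟶ tensorList (fun i => F.obj (X i)) l',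
      IsPermutation (fun i => F.obj (X i)) m' ∧
        F.map m ≫ oplaxList F X l' = oplaxList F X l ≫ m' := by
  induction h with
  | nil =>
    have : F.map (𝟙 (𝟙_ V)) ≫ η F = η F ≫ 𝟙 _ := by simp
    exact ⟨_, .nil, this⟩
  | cons a _ ih =>
    obtain ⟨m', hm', e⟩ := ih
    refine ⟨_, hm'.cons a, ?_⟩
    have := oplax_tensorHom F (𝟙 (X a)) _ _ _ _ e
    rw [F.map_id, id_tensorHom, id_tensorHom] at this
    exact this
  | swap a b l =>
    exact ⟨_, .swap a b l, oplax_crossing F _ _ OplaxBraided.braided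
      (fun f g => BraidedCategory.braiding_naturality f g) _ _ _ _⟩
  | comp _ _ ih ih' =>
    obtain ⟨m, hm, e⟩ := ih
    obtain ⟨m', hm', e'⟩ := ih'
    exact ⟨_, hm.comp hm', by rw [F.map_comp, Category.assoc, e', reassoc_of% e]⟩

namespace Diagram

/-- The image of a diagram under a colax monoidal functor. -/
def oplax {T : V} (D : Diagram X T) : Diagram (fun i => F.obj (X i)) (F.obj T) :=
  ⟨D.word, F.map D.hom ≫ oplaxList F X D.word⟩

lemma oplax_pre {S T : V} (s : S ⟶ T) (D : Diagram X T) :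
    oplax F (D.pre s) = (oplax F D).pre (F.map s) :=
  congrArg (Diagram.mk _) (by simp [pre, oplax])

lemma oplax_cons {T : V} (a : ι) (D : Diagram X T) :
    oplax F (D.cons a) = pre (δ F (X a) T) (cons a (oplax F D)) := by
  have h : ∀ {A T L : V} {M : W} (u : T ⟶ L) (d : F.obj L ⟶ M),
      F.map (A ◁ u) ≫ δ F A L ≫ F.obj A ◁ d = δ F A T ≫ F.obj A ◁ (F.map u ≫ d) := by
    intros
    simp
  exact congrArg (Diagram.mk _) (h _ _)

lemma oplax_step (c : ∀ A B : V, A ⊗ B ≅ B ⊗ A) (c' : ∀ A B : W, A ⊗ B ≅ B ⊗ A)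
    (h : ∀ A B, F.map (c A B).hom ≫ δ F B A = δ F A B ≫ (c' (F.obj A) (F.obj B)).hom)
    (hc : ∀ {A A' B B' : W} (f : A ⟶ A') (g : B ⟶ B'),
      (f ⊗ₘ g) ≫ (c' A' B').hom = (c' A B).hom ≫ (g ⊗ₘ f))
    (i : ℕ) {T : V} (D : Diagram X T) :
    oplax F (step c i D) = step c' i (oplax F D) := by
  obtain ⟨l, u⟩ := D
  have triv : ∀ {T L : V} {M : W} (u : T ⟶ L) (d : F.obj L ⟶ M),
      F.map (u ≫ 𝟙 _) ≫ d = (F.map u ≫ d) ≫ 𝟙 _ := by simp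
  induction i generalizing T l with
  | zero =>
    match l, u with
    | [], u => exact congrArg (Diagram.mk _) (triv _ _)
    | [a], u => exact congrArg (Diagram.mk _) (triv _ _)
    | a :: b :: l, u =>
      have h' : ∀ {A B L : V} (u : T ⟶ A ⊗ (B ⊗ L)) {M : W} (d : F.obj L ⟶ M),
          F.map (u ≫ (crossing c A B L).hom) ≫
            δ F B (A ⊗ L) ≫ F.obj B ◁ (δ F A L ≫ F.obj A ◁ d) =
          (F.map u ≫ δ F A (B ⊗ L) ≫ F.obj A ◁ (δ F B L ≫ F.obj B ◁ d)) ≫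
            (crossing c' (F.obj A) (F.obj B) M).hom := by
        intro A B L u M d
        rw [F.map_comp, Category.assoc, oplax_crossing F c c' h hc]
        simp only [Category.assoc]
      exact congrArg (Diagram.mk _) (h' u _)
  | succ i ih =>
    match l, u with
    | [], u => exact congrArg (Diagram.mk _) (triv _ _)
    | a :: l, u =>
      obtain ⟨s, hs⟩ := exists_pre_cons a l u
      rw [hs]
      simp only [step_pre, step_cons, oplax_pre, oplax_cons, ih]

end Diagram

lemma braidAction_oplax [BraidedCategory V] [BraidedCategory W] [OplaxBraided F] {n : ℕ} {T : V}
    (b : BraidGroup n) : ∀ D : {D : Diagram X T // D.word.length = n},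
      braidAction n _ _ b ⟨D.1.oplax F, D.2⟩ =
        ⟨(braidAction n _ _ b D).1.oplax F, (braidAction n _ _ b D).2⟩ := by
  induction b using braid_induction with
  | one => intro D; simp
  | of i =>
    intro D
    rw [braidAction_of, braidAction_of]
    exact Subtype.ext
      (Diagram.oplax_step F _ _ OplaxBraided.braided posBraiding_natural _ _).symm
  | inv_of i =>
    intro D
    rw [map_inv, map_inv, braidAction_of, braidAction_of]
    exact Subtype.ext
      (Diagram.oplax_step F _ _ (oplax_negBraiding F) negBraiding_natural _ _).symm
  | mul a b ha hb =>
    intro D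
    rw [map_mul, map_mul, Equiv.Perm.mul_apply, Equiv.Perm.mul_apply, hb, ha]

lemma symmetric_naturality [SymmetricCategory V] [SymmetricCategory W] [OplaxBraided F]
    {n : ℕ} {X Y : Fin n → V} (π : Equiv.Perm (Fin n)) (f : FamilyOver π X Y)
    (p : ((List.finRange n).map π).Perm (List.finRange n)) :
    F.map (tensorListPush f (List.finRange n) ≫ permute Y p) ≫ oplaxList F Y (List.finRange n) =
      oplaxList F X (List.finRange n) ≫ tensorListPush (X := fun i => F.obj (X i))
        (Y := fun i => F.obj (Y i)) (fun i j h => F.map (f i j h)) (List.finRange n) ≫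
        permute (fun i => F.obj (Y i)) p := by
  obtain ⟨m, hm, e⟩ := (permute_spec Y p).oplax F
  rw [F.map_comp, Category.assoc, e, reassoc_of% oplaxList_tensorListPush F f]
  congr 2
  exact hm.eq_of_nodup (permute_spec _ _) (List.nodup_finRange n)

lemma braided_naturality [BraidedCategory V] [BraidedCategory W] [OplaxBraided F]
    {n : ℕ} {X Y : Wreath (braidPerm n) V} (f : Wreath.Hom X Y)
    (f' : Wreath.Hom (⟨fun i => F.obj (X.obj i)⟩ : Wreath (braidPerm n) W)
      ⟨fun i => F.obj (Y.obj i)⟩) (hf : f' = ⟨f.elt, fun i j h => F.map (f.map i j h)⟩) :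
    F.map (braidedTensorMap f) ≫ oplaxList F Y.obj (List.finRange n) =
      oplaxList F X.obj (List.finRange n) ≫ braidedTensorMap f' := by
  have h := braidAction_oplax F f.elt f.diagram
  have h₀ : (⟨f.diagram.1.oplax F, f.diagram.2⟩ : {D : Diagram (fun i => F.obj (Y.obj i))
      (F.obj (tensorList X.obj (List.finRange n))) // D.word.length = n}) =
      ⟨(Wreath.Hom.diagram f').1.pre (oplaxList F X.obj _), (Wreath.Hom.diagram f').2⟩ := by
    subst hf
    exact Subtype.ext (congrArg (Diagram.mk _) (oplaxList_tensorListPush F f.map _))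
  have e : f.elt = f'.elt := by rw [hf]
  rw [h₀, braidAction_pre, braidAction_diagram f, e, braidAction_diagram f'] at h
  have h' := congrArg Subtype.val h
  injection h' with _ h'
  exact h'.symm

end Oplax

section Squares

variable {V : Type u₁} [Category.{v₁} V] [MonoidalCategory V]
  {W : Type u₂} [Category.{v₂} W] [MonoidalCategory W]

/-- The action (tensor product functor) of the pseudo algebra that a monoidal category is. -/
def FreeMonoidal.action (V : Type u) [Category.{v} V] [MonoidalCategory V] :
    FreeMonoidal V ⥤ V :=
  Sigma.desc (tensorPi V)

/-- The action (tensor product functor) of the pseudo algebra that a symmetric monoidal category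
is. -/
noncomputable def FreeSymmetric.action (V : Type u) [Category.{v} V] [MonoidalCategory V]
    [SymmetricCategory V] : FreeSymmetric V ⥤ V :=
  Sigma.desc (tensorSymmetric V)

/-- The action (tensor product functor) of the pseudo algebra that a braided monoidal category
is. -/
def FreeBraided.action (V : Type u) [Category.{v} V] [MonoidalCategory V]
    [BraidedCategory V] : FreeBraided V ⥤ V :=
  Sigma.desc (tensorBraided V)

/-- The square of the colax morphism of pseudo algebras, for the 2-monad for monoidal categories, given
by a colax monoidal functor `F`: the 2-cell `F ∘ ⨂ ⟶ ⨂ ∘ FreeMonoidal.map F` whose components are the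
iterated comparison maps. The colax morphism is exact when this square is exact in the sense of
Guitart. -/
def monoidalSquare (F : V ⥤ W) [F.OplaxMonoidal] :
    TwoSquare (FreeMonoidal.action V) (FreeMonoidal.map F) F (FreeMonoidal.action W) :=
  Sigma.natTrans fun n =>
    { app := fun X => oplaxList F X (List.finRange n)
      naturality := fun _ _ f => oplaxList_tensorListHom F f _ }

/-- The square of the colax morphism of pseudo algebras, for the 2-monad for symmetric monoidal
categories, given by a symmetric colax monoidal functor `F`. -/
noncomputable def symmetricSquare [SymmetricCategory V] [SymmetricCategory W] (F : V ⥤ W) [F.OplaxMonoidal]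
    [OplaxBraided F] :
    TwoSquare (FreeSymmetric.action V) (FreeSymmetric.map F) F (FreeSymmetric.action W) :=
  Sigma.natTrans fun n =>
    { app := fun X => oplaxList F X.obj (List.finRange n)
      naturality := fun _ _ f => symmetric_naturality F f.elt f.map _ }

/-- The square of the colax morphism of pseudo algebras, for the 2-monad for braided monoidal
categories, given by a braided colax monoidal functor `F`. -/
def braidedSquare [BraidedCategory V] [BraidedCategory W] (F : V ⥤ W) [F.OplaxMonoidal]
    [OplaxBraided F] :
    TwoSquare (FreeBraided.action V) (FreeBraided.map F) F (FreeBraided.action W) :=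
  Sigma.natTrans fun n =>
    { app := fun X => oplaxList F X.obj (List.finRange n)
      naturality := fun _ _ f => braided_naturality F f _ rfl }

end Squares

end ExactColax

/-! Both equivalences are one statement about wreath products. Let groups `G n` act on `n` letters
through `ρ n`, and let `T` be the resulting functor of sequences; the symmetric and braided cases
are `ρ n` the identity and `ρ n = braidPerm n`. The families over the unit of the group give an
inclusion of `FreeMonoidal V` into `TV`, natural in `V`. Pasting its naturality square for `F` to
the `T`-algebra square of `F` gives the monoidal square, since the unit of the group acts trivially
on tensor products.

The naturality square is exact (the instance on `wreathSquare`). A morphism `γ : TF(X) ⟶ Y` over `g`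
has to be factored as `TF(a)`, with `a : X ⟶ Z`, followed by a family `b` over the unit. Then `a`
must lie over `g`, so it is the canonical morphism from `X` to its permuted sequence followed by a
family of morphisms. Hence one factorization maps to all others (`Wreath.exists_factorization`), and
the category of factorizations is connected.

The inclusion is moreover bijective on objects. Pasting with an exact square whose horizontal
functors are essentially surjective neither creates nor destroys exactness, and this yields
`guitartExact_iff_of_wreath`. The symmetry or braiding of `F` enters only in making the `T`-square
natural. -/

namespace ExactColax

/-! ### Tensor products of families over a trivial permutation -/

section Push

variable {V : Type u} [Category.{v} V] [MonoidalCategory V] {ι : Type w}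

/-- This is what compares the symmetric and braided actions with the monoidal one on morphisms over
the unit. Stating it for diagrams absorbs the change of word from `l` to `l.map σ`, so that no
transport appears. The morphism `u` is arbitrary because the induction changes the source. -/
lemma Diagram.push_of_fixed {X Y : ι → V} {T : V} {σ : Equiv.Perm ι} (k : FamilyOver σ X Y)
    (f : ∀ i, X i ⟶ Y i) (hσ : ∀ i, σ i = i) (hk : ∀ i, k i i (hσ i) = f i) (l : List ι)
    (u : T ⟶ tensorList X l) :
    push k (⟨l, u⟩ : Diagram X T) = ⟨l, u ≫ tensorListHom f l⟩ := by
  induction l generalizing T with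
  | nil => rfl
  | cons a l ih =>
    obtain ⟨s, hs⟩ := exists_pre_cons a l u
    have hs' : u = s ≫ X a ◁ 𝟙 (tensorList X l) := by
      injection hs
    rw [hs, push_pre, push_cons, ih]
    -- The equation `σ a = a` cannot be eliminated as it stands; with `σ a` replaced by a variable
    -- `b` it can.
    have key : ∀ b (hb : σ a = b) (hab : b = a),
        pre (k a b hb ▷ _) (cons b (⟨l, 𝟙 _ ≫ tensorListHom f l⟩ : Diagram Y _)) =
          ⟨a :: l, f a ⊗ₘ tensorListHom f l⟩ := by
      rintro b hb rfl
      rw [hk]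
      have h : ∀ {A B L M : V} (p : A ⟶ B) (q : L ⟶ M), p ▷ L ≫ B ◁ (𝟙 _ ≫ q) = p ⊗ₘ q := by
        simp [MonoidalCategory.tensorHom_def]
      exact congrArg (Diagram.mk _) (h _ _)
    rw [key _ rfl (hσ a), hs']
    have h : ∀ {A L M : V} (s : T ⟶ A ⊗ L) (p : A ⊗ L ⟶ M), s ≫ p = (s ≫ A ◁ 𝟙 L) ≫ p := by simp
    exact congrArg (Diagram.mk _) (h _ _)

end Push

/-! ### Factorizations in the wreath product -/

namespace Wreath

variable {n : ℕ} {G : Type} [Group G] (ρ : G →* Equiv.Perm (Fin n))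
  (V : Type u) [Category.{v} V]

/-- The functor from sequences to the wreath product that is the identity on objects and sends a
family of morphisms to itself, over the unit of the group. -/
def ofPi : (Fin n → V) ⥤ Wreath ρ V where
  obj X := ⟨X⟩
  map {X Y} f := ⟨1, fun i _ h => f i ≫ eqToHom (congrArg Y (by rw [← h, map_one]; rfl))⟩
  map_id X := Hom.ext' rfl fun _ _ _ _ => Category.id_comp _
  map_comp {X Y Z} f g := by
    refine Hom.ext' (one_mul 1).symm ?_
    intro i j h _
    obtain rfl : i = j := by rw [← h, map_one]; rfl
    -- The composite passes through the index `ρ 1 i`, here generalized to a variable `k`.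
    have key : ∀ k (hk : i = k), f i ≫ g i =
        (f i ≫ eqToHom (congrArg Y hk)) ≫ g k ≫ eqToHom (congrArg Z hk.symm) := by
      rintro k rfl
      simp
    exact ((congrArg (_ ≫ ·) (eqToHom_refl _ _)).trans (Category.comp_id _)).trans
      (key _ (by rw [map_one]; rfl))

variable {ρ V}

/-- Multiplying by the unit does not change the group element. This form, free of `eqToHom`, serves
to compare composites componentwise. -/
lemma comp_ofPi_map {X : Wreath ρ V} {Y Z : Fin n → V} (a : X ⟶ (ofPi ρ V).obj Y) (f : Y ⟶ Z) :
    a ≫ (ofPi ρ V).map f = (⟨a.elt, fun i j h => a.map i j h ≫ f j⟩ : Hom X _) := by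
  refine Hom.ext' (one_mul _) ?_
  intro i j _ h
  subst h
  exact congrArg (a.map i _ rfl ≫ ·) (Category.comp_id _)

/-- The sequence obtained by permuting the entries of `X` according to `g`. -/
def permuted (X : Wreath ρ V) (g : G) : Fin n → V := fun j => X.obj ((ρ g).symm j)

/-- The canonical morphism over `g` from `X` to the permuted sequence. -/
def toPermuted (X : Wreath ρ V) (g : G) : X ⟶ (ofPi ρ V).obj (X.permuted g) :=
  Hom.mk g fun i _ h => eqToHom (congrArg X.obj (by rw [← h, Equiv.symm_apply_apply]))

/-- A morphism out of `X` over `g` amounts to a family of morphisms out of `X.permuted g`. -/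
lemma exists_toPermuted_comp {X : Wreath ρ V} {Z : Fin n → V} (a : X ⟶ (ofPi ρ V).obj Z)
    {g : G} (hg : a.elt = g) :
    ∃ f : X.permuted g ⟶ Z, X.toPermuted g ≫ (ofPi ρ V).map f = a := by
  -- The group element is a separate variable so that the lemma applies when `g` comes from another
  -- morphism and equals `a.elt` only propositionally.
  subst hg
  -- Each position `j` is reached from exactly one index, its preimage under `ρ a.elt`; the
  -- component of `a` there is the one required.
  refine ⟨fun j => a.map _ j (Equiv.apply_symm_apply _ j), ?_⟩
  refine (comp_ofPi_map _ _).trans (Hom.ext' rfl ?_)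
  intro i j h hj
  have key : ∀ k (hk : i = k) (h' : ρ a.elt k = j),
      eqToHom (congrArg X.obj hk) ≫ a.map k j h' = a.map i j hj := by
    rintro k rfl h'
    simp
  exact key _ (by rw [← hj]; exact (Equiv.symm_apply_apply _ _).symm) _

/-- Every `j` is hit by the index `(ρ g).symm j`, and the component of `toPermuted` there is
invertible, so `f j` can be read off from the composite. -/
lemma toPermuted_comp_injective {X : Wreath ρ V} {g : G} {Z : Fin n → V}
    {f f' : X.permuted g ⟶ Z}
    (h : X.toPermuted g ≫ (ofPi ρ V).map f = X.toPermuted g ≫ (ofPi ρ V).map f') : f = f' := by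
  rw [comp_ofPi_map, comp_ofPi_map] at h
  injection h with _ h
  funext j
  have h₁ := congrFun (congrFun (congrFun h ((ρ g).symm j)) j)
    (Equiv.apply_symm_apply _ j)
  exact (cancel_epi (eqToHom (rfl : X.obj ((ρ g).symm j) = X.permuted g j))).1 h₁

variable {W : Type u₂} [Category.{v₂} W] (F : V ⥤ W)

/-- The components are transports along equalities of objects, which any functor preserves. -/
lemma mapFunctor_map_toPermuted (X : Wreath ρ V) (g : G) :
    (mapFunctor ρ F).map (X.toPermuted g) = ((mapFunctor ρ F).obj X).toPermuted g :=
  Hom.ext' rfl fun i _ h _ => eqToHom_map F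
    (congrArg X.obj (show i = (ρ g).symm _ by rw [← h]; exact (Equiv.symm_apply_apply _ _).symm))

/-- This is the naturality, in each length, that makes `wreathSquare` commute strictly. -/
lemma mapFunctor_map_ofPi_map {X Y : Fin n → V} (f : X ⟶ Y) :
    (mapFunctor ρ F).map ((ofPi ρ V).map f) = (ofPi ρ W).map ((piMap n F).map f) := by
  refine Hom.ext' rfl ?_
  intro i j h _
  exact (F.map_comp _ _).trans (congrArg (F.map (f i) ≫ ·) (eqToHom_map F _))

/-- Any factorization of `γ` receives a morphism from the one given by
`toPermuted`. -/
lemma exists_factorization {X : Wreath ρ V} {Y : Fin n → W}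
    (γ : (mapFunctor ρ F).obj X ⟶ (ofPi ρ W).obj Y) :
    ∃ b₀ : (piMap n F).obj (X.permuted γ.elt) ⟶ Y,
      (mapFunctor ρ F).map (X.toPermuted γ.elt) ≫ (ofPi ρ W).map b₀ = γ ∧
      ∀ (Z : Fin n → V) (a : X ⟶ (ofPi ρ V).obj Z) (b : (piMap n F).obj Z ⟶ Y),
        (mapFunctor ρ F).map a ≫ (ofPi ρ W).map b = γ →
        ∃ f : X.permuted γ.elt ⟶ Z, X.toPermuted γ.elt ≫ (ofPi ρ V).map f = a ∧
          (piMap n F).map f ≫ b = b₀ := by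
  obtain ⟨b₀, hb₀⟩ := exists_toPermuted_comp γ rfl
  refine ⟨b₀, by rw [mapFunctor_map_toPermuted]; exact hb₀, fun Z a b h => ?_⟩
  -- As `b` contributes the unit, comparing group elements in `h` gives `1 * a.elt = γ.elt`.
  obtain ⟨f, hf⟩ := exists_toPermuted_comp a (g := γ.elt)
    ((one_mul _).symm.trans (congrArg Hom.elt h))
  -- The compatibility with `b₀` may be checked after precomposing with the canonical morphism,
  -- where both sides become `γ`.
  refine ⟨f, hf, toPermuted_comp_injective (X := (mapFunctor ρ F).obj X) (g := γ.elt) ?_⟩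
  refine (congrArg (_ ≫ ·) ((ofPi ρ W).map_comp ((piMap n F).map f) b)).trans
    (Eq.trans ?_ (h.trans hb₀.symm))
  rw [← hf, Functor.map_comp, mapFunctor_map_toPermuted, mapFunctor_map_ofPi_map]
  exact (Category.assoc _ _ _).symm

end Wreath

/-! ### Exactness of the inclusion square and pasting -/

section Comparison

variable {G : ℕ → Type} [∀ n, Group (G n)] (ρ : ∀ n, G n →* Equiv.Perm (Fin n))

/-- The inclusion of the sequences of morphisms into the morphisms of the wreath products. -/
def wreathIncl (V : Type u) [Category.{v} V] : FreeMonoidal V ⥤ Σ n, Wreath (ρ n) V :=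
  Sigma.desc fun n => Wreath.ofPi (ρ n) V ⋙ Sigma.incl (C := fun n => Wreath (ρ n) V) n

/-- The two categories have the same objects. Hence exactness tested on targets coming from
`FreeMonoidal W` covers all targets. -/
instance (V : Type u) [Category.{v} V] : (wreathIncl ρ V).EssSurj where
  mem_essImage := fun ⟨n, X⟩ => ⟨⟨n, X.obj⟩, ⟨Iso.refl _⟩⟩

variable {V : Type u₁} [Category.{v₁} V] {W : Type u₂} [Category.{v₂} W] (F : V ⥤ W)

/-- Apply a functor to each entry of a sequence of objects. -/
def wreathMap : (Σ n, Wreath (ρ n) V) ⥤ Σ n, Wreath (ρ n) W :=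
  Sigma.desc fun n => Wreath.mapFunctor (ρ n) F ⋙ Sigma.incl (C := fun n => Wreath (ρ n) W) n

/-- The naturality square of `wreathIncl`. -/
def wreathSquare :
    TwoSquare (wreathIncl ρ V) (FreeMonoidal.map F) (wreathMap ρ F) (wreathIncl ρ W) :=
  Sigma.natTrans fun n =>
    { app := fun X => 𝟙 (⟨n, ⟨fun i => F.obj (X i)⟩⟩ : Σ n, Wreath (ρ n) W)
      naturality := fun X Y f => by
        refine (Category.comp_id _).trans (Eq.trans ?_ (Category.id_comp _).symm)
        exact congrArg Sigma.SigmaHom.mk (Wreath.mapFunctor_map_ofPi_map F f) }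

/-- The factorization through the permuted sequence maps to every other one, and a category with
such an object is connected. -/
instance : (wreathSquare ρ F).GuitartExact := by
  rw [TwoSquare.guitartExact_iff_isConnected_rightwards]
  rintro ⟨n, X⟩ ⟨m, Y⟩ (γ : Sigma.SigmaHom ⟨n, _⟩ ⟨m, _⟩)
  -- A morphism exists only between sequences of equal length, so this identifies `m` with `n`.
  obtain ⟨γ⟩ := γ
  obtain ⟨b₀, h₀, hb₀⟩ := Wreath.exists_factorization F γ
  let S : (wreathSquare ρ F).StructuredArrowRightwards (X₂ := ⟨n, X⟩) (X₃ := ⟨n, Y⟩)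
      (Sigma.SigmaHom.mk γ) :=
    .mk _ _ ⟨n, X.permuted γ.elt⟩ (.mk (X.toPermuted γ.elt)) (.mk b₀)
      ((congrArg (_ ≫ ·) (Category.id_comp _)).trans (congrArg Sigma.SigmaHom.mk h₀))
  have hS : ∀ A, Nonempty (S ⟶ A) := by
    intro A
    obtain ⟨⟨k, Z⟩, a, b, h, rfl⟩ := TwoSquare.StructuredArrowRightwards.mk_surjective A
    change Sigma.SigmaHom ⟨n, _⟩ ⟨k, _⟩ at a
    change Sigma.SigmaHom ⟨k, _⟩ ⟨n, _⟩ at b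
    obtain ⟨a⟩ := a
    obtain ⟨b⟩ := b
    -- The 2-cell of the square is an identity and is removed from the factorization equation.
    have h' := (congrArg (_ ≫ ·) (Category.id_comp _)).symm.trans h
    obtain ⟨f, hf, hfb⟩ := hb₀ Z a b (by injection h')
    exact ⟨StructuredArrow.homMk (CostructuredArrow.homMk (Sigma.SigmaHom.mk f)
      (congrArg Sigma.SigmaHom.mk hfb))
      (by ext; exact congrArg Sigma.SigmaHom.mk hf)⟩
  have : Nonempty _ := ⟨S⟩
  -- The zigzag is `A ⟵ S ⟶ B`; uniqueness of the two arrows is not needed.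
  exact zigzag_isConnected fun A B => .of_inv_hom (hS A).some (hS B).some

/-- If the action of the wreath products extends the action of sequences, compatibly with a colax
structure, then exactness with respect to either action is the same condition. -/
lemma guitartExact_iff_of_wreath [MonoidalCategory V] [MonoidalCategory W] [F.OplaxMonoidal]
    {TV : (Σ n, Wreath (ρ n) V) ⥤ V} {TW : (Σ n, Wreath (ρ n) W) ⥤ W}
    (s : TwoSquare TV (wreathMap ρ F) F TW)
    (eV : wreathIncl ρ V ⋙ TV ≅ FreeMonoidal.action V)
    (eW : wreathIncl ρ W ⋙ TW ≅ FreeMonoidal.action W)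
    (h : ∀ X, F.map (eV.hom.app X) ≫ (monoidalSquare F).app X =
      s.app ((wreathIncl ρ V).obj X) ≫ eW.hom.app ((FreeMonoidal.map F).obj X)) :
    s.GuitartExact ↔ (monoidalSquare F).GuitartExact := by
  -- Replaces `s` by its pasting with the exact inclusion square; it remains to identify this
  -- pasting.
  rw [← TwoSquare.GuitartExact.hComp'_iff_of_essSurj (wreathSquare ρ F) s eV eW]
  have : (wreathSquare ρ F).hComp' s eV eW = monoidalSquare F := by
    ext X
    have e : (wreathSquare ρ F).app X = 𝟙 _ := rfl
    have h₁ : F.map (eV.inv.app X) ≫ F.map (eV.hom.app X) = 𝟙 _ := by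
      rw [← F.map_comp]; simp
    -- The pasted component is `s` conjugated by `eV` and `eW`; by `h` it is the monoidal comparison
    -- preceded by `F` of `eV.inv` and `eV.hom`, which cancel.
    refine Eq.trans ?_ ((congrArg (F.map (eV.inv.app X) ≫ ·) (h X).symm).trans
      ((reassoc_of% h₁) _))
    simp [e]
    exact congrArg (fun t => _ ≫ _ ≫ t)
      ((congrArg (· ≫ _) (TW.map_id _)).trans (Category.id_comp _))
  rw [this]

end Comparison

/-! ### Restriction of the symmetric and braided actions to sequences -/

section Actions

variable (V : Type u) [Category.{v} V] [MonoidalCategory V]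

/-- The symmetric action restricts to the monoidal action. -/
noncomputable def wreathInclSymmetric [SymmetricCategory V] :
    wreathIncl (fun n => MonoidHom.id (Equiv.Perm (Fin n))) V ⋙ FreeSymmetric.action V ≅
      FreeMonoidal.action V :=
  Sigma.natIso fun n => NatIso.ofComponents
    (fun X => Iso.refl (tensorList X (List.finRange n)))
    (fun {X Y} f => by
      refine (Category.comp_id _).trans (Eq.trans ?_ (Category.id_comp _).symm)
      have h := Diagram.push_of_fixed
        (((Wreath.ofPi (MonoidHom.id (Equiv.Perm (Fin n))) V).map f).map) f (fun _ => rfl)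
        (fun _ => Category.comp_id _) (List.finRange n) (𝟙 _)
      have := Diagram.comp_permute_congr h (Equiv.Perm.map_finRange_perm _) (List.Perm.refl _)
      simp only [Diagram.push, Category.id_comp] at this
      refine this.trans ((congrArg (_ ≫ ·) ?_).trans (Category.comp_id _))
      -- The remaining symmetry coherence goes from a list to itself; as its indices are distinct,
      -- it is forced to be the identity.
      exact (permute_spec _ _).eq_of_nodup (IsPermutation.id _ _) (List.nodup_finRange n))

/-- The braided action restricts to the monoidal action. -/
def wreathInclBraided [BraidedCategory V] :
    wreathIncl braidPerm V ⋙ FreeBraided.action V ≅ FreeMonoidal.action V :=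
  Sigma.natIso fun n => NatIso.ofComponents
    (fun X => Iso.refl (tensorList X (List.finRange n)))
    (fun {X Y} f => by
      refine (Category.comp_id _).trans (Eq.trans ?_ (Category.id_comp _).symm)
      -- It suffices to compute the braid action on the tensor product of the components. The braid
      -- is the unit, so it acts trivially and `push_of_fixed` gives the result.
      apply braidedTensorMap_eq
      have h := Diagram.push_of_fixed (((Wreath.ofPi (braidPerm n) V).map f).map) f
        (fun i => by change braidPerm n 1 i = i; simp)
        (fun _ => Category.comp_id _) (List.finRange n) (𝟙 _)
      have e : Wreath.Hom.elt ((Wreath.ofPi (braidPerm n) V).map f) = 1 := rfl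
      simp only [Diagram.push, Category.id_comp] at h
      rw [e, map_one]
      exact Subtype.ext h)

end Actions

end ExactColax

theorem proposition4p17 :
    (∀ {V : Type u₁} [Category.{v₁} V] [MonoidalCategory V] [SymmetricCategory V]
      {W : Type u₂} [Category.{v₂} W] [MonoidalCategory W] [SymmetricCategory W]
      (F : V ⥤ W) [F.OplaxMonoidal] [ExactColax.OplaxBraided F],
      (ExactColax.symmetricSquare F).GuitartExact ↔ (ExactColax.monoidalSquare F).GuitartExact) ∧
    (∀ {V : Type u₁} [Category.{v₁} V] [MonoidalCategory V] [BraidedCategory V]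
      {W : Type u₂} [Category.{v₂} W] [MonoidalCategory W] [BraidedCategory W]
      (F : V ⥤ W) [F.OplaxMonoidal] [ExactColax.OplaxBraided F],
      (ExactColax.braidedSquare F).GuitartExact ↔ (ExactColax.monoidalSquare F).GuitartExact) := by
  constructor
  · intro V _ _ _ W _ _ _ F _ _
    -- `FreeSymmetric.map F` is by definition a `wreathMap`. The comparison isomorphisms have
    -- identity components and both squares have components `oplaxList`, so compatibility reduces to
    -- unit laws.
    exact ExactColax.guitartExact_iff_of_wreath _ F (ExactColax.symmetricSquare F)
      (ExactColax.wreathInclSymmetric V) (ExactColax.wreathInclSymmetric W)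
      fun _ => (congrArg (· ≫ _) (F.map_id _)).trans
        ((Category.id_comp _).trans (Category.comp_id _).symm)
  · intro V _ _ _ W _ _ _ F _ _
    exact ExactColax.guitartExact_iff_of_wreath _ F (ExactColax.braidedSquare F)
      (ExactColax.wreathInclBraided V) (ExactColax.wreathInclBraided W)
      fun _ => (congrArg (· ≫ _) (F.map_id _)).trans
        ((Category.id_comp _).trans (Category.comp_id _).symm)
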